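/- Let $d\ge 1$, $1<p<\infty$, $1\le\theta\le\infty$, let $r=(r_1,\dots,r_d)$ with all $r_j>0$, and put $$g(r)=\Big(\frac1d\sum_{j=1}^d\frac1{r_j}\Big)^{-1},\qquad a_j=2^{g(r)/r_j},\qquad a^s=(a_1^s,\dots,a_d^s)\quad(s=0,1,2,\dots).$$ For $\sigma=(\sigma_1,\dots,\sigma_d)$ with $\sigma_j>0$ and a complex-valued $f\in L_p(\mathbb R^d)$ let $$S_\sigma f(x)=\frac1{\pi^{d}}\int_{\mathbb R^d}f(y)\prod_{j=1}^d\frac{\sin \sigma_j(x_j-y_j)}{x_j-y_j}\,dy$$ be the section of the Fourier integral of $f$; equivalently, the Fourier transform of $S_\sigma f$ (in the sense of tempered distributions) is the Fourier transform of $f$ multiplied by the indicator function of the box $\{|\lambda_j|<\sigma_j,\ j=1,\dots,d\}$. Let $f_{a^0}=S_{a^0}f$ and $f_{a^s}=S_{a^s}f-S_{a^{s-1}}f$ for $s\ge1$. Let $B^r_{p,\theta}$ be the set of all $f\in L_p(\mathbb R^d)$ such that $$\Big(\sum_{s=0}^\infty 2^{s g(r)\theta}\,\|f_{a^s}\|_p^\theta\Big)^{1/\theta}\le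 1\quad(\theta<\infty),\qquad \sup_{s\ge0}2^{s g(r)}\|f_{a^s}\|_p\le 1\quad(\theta=\infty).$$ Theorem. If $g(r)>d/p$, then $B^r_{p,\theta}\subset L_\infty(\mathbb R^d)$, and there are constants $c,C>0$, independent of $n$, such that for all integers $n\ge1$ $$c\,2^{-n(g(r)-d/p)}\;\le\;\sup_{f\in B^r_{p,\theta}}\big\|f-S_{a^{n-1}}f\big\|_{\infty}\;\le\;C\,2^{-n(g(r)-d/p)}.$$ -/

import Mathlib

open MeasureTheory
open scoped ENNReal

namespace NikolskiiBesov

noncomputable section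

/-- The space `ℝ^d` with its Euclidean structure and Lebesgue measure. -/
abbrev Space (d : ℕ) : Type := EuclideanSpace ℝ (Fin d)

/-- The kernel `π^{-d} ∏_j sin (σ_j t_j) / t_j` of the sections of the Fourier integral.  It is
written with `Real.sinc u = sin u / u`, `Real.sinc 0 = 1`, so that it is continuous in `t`. -/
def kernel {d : ℕ} (σ : Fin d → ℝ) (t : Space d) : ℝ :=
  (Real.pi ^ d)⁻¹ * ∏ j, (σ j * Real.sinc (σ j * t j))

/-- The section `S_σ f` of the Fourier integral of `f ∈ L_p`, `1 < p < ∞`, corresponding to the box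
`|λ_j| < σ_j`:
`S_σ f (x) = π^{-d} ∫ f(y) ∏_j sin (σ_j (x_j - y_j)) / (x_j - y_j) dy`.
The integral converges absolutely for every `x`, by Hölder's inequality.  The theorems
`fourierSection_eq_integral` and `integral_fourierSection_mul` below show that `S_σ` is the
operator which acts as multiplication by the indicator function of the box on the side of
the Fourier transform. -/
def fourierSection {d : ℕ} (σ : Fin d → ℝ) (f : Space d → ℂ) (x : Space d) : ℂ :=
  ∫ y, f y * (kernel σ (x - y) : ℂ)

/-- The harmonic mean `g(r) = (d⁻¹ ∑_j 1 / r_j)⁻¹`. -/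
def harmonicMean {d : ℕ} (r : Fin d → ℝ) : ℝ :=
  ((d : ℝ)⁻¹ * ∑ j, 1 / r j)⁻¹

/-- The vector `a^s = (a_1^s, …, a_d^s)`, where `a_j = 2^{g(r) / r_j}`. -/
def scale {d : ℕ} (r : Fin d → ℝ) (s : ℕ) (j : Fin d) : ℝ :=
  ((2 : ℝ) ^ (harmonicMean r / r j)) ^ s

/-- The layers of `f`: `f_{a^0} = S_{a^0} f` and `f_{a^s} = S_{a^s} f - S_{a^{s-1}} f`, `s ≥ 1`. -/
def layer {d : ℕ} (r : Fin d → ℝ) (f : Space d → ℂ) : ℕ → Space d → ℂ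
  | 0 => fourierSection (scale r 0) f
  | s + 1 => fun x => fourierSection (scale r (s + 1)) f x - fourierSection (scale r s) f x

/-- The norm `(∑_s (b^s ‖f_{a^s}‖_p)^θ)^{1/θ}` (`sup_s b^s ‖f_{a^s}‖_p` if `θ = ∞`) of the
anisotropic Nikol'skii-Besov space, `b = 2^{g(r)}`, as an element of `[0, ∞]`. -/
def besovNorm {d : ℕ} (r : Fin d → ℝ) (p θ : ℝ≥0∞) (f : Space d → ℂ) : ℝ≥0∞ :=
  if θ = ∞ then
    ⨆ s : ℕ, ENNReal.ofReal (((2 : ℝ) ^ harmonicMean r) ^ s) * eLpNorm (layer r f s) p volume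
  else
    (∑' s : ℕ, (ENNReal.ofReal (((2 : ℝ) ^ harmonicMean r) ^ s) *
      eLpNorm (layer r f s) p volume) ^ θ.toReal) ^ (1 / θ.toReal)

/-- The class `B^r_{p,θ}(ℝ^d)`: the unit ball of the Nikol'skii-Besov space. -/
def besovClass {d : ℕ} (r : Fin d → ℝ) (p θ : ℝ≥0∞) : Set (Space d → ℂ) :=
  {f | MemLp f p volume ∧ besovNorm r p θ f ≤ 1}

/-- The error `‖f - S_{a^{n-1}} f‖_∞`, for `n ≥ 1`. -/
def sectionError {d : ℕ} (r : Fin d → ℝ) (n : ℕ) (f : Space d → ℂ) : ℝ≥0∞ :=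
  eLpNorm (fun x => f x - fourierSection (scale r (n - 1)) f x) ∞ volume

/-- The worst-case error `sup_{f ∈ F} ‖f - S_{a^{n-1}} f‖_∞` over a class `F`, for `n ≥ 1`. -/
def classError {d : ℕ} (r : Fin d → ℝ) (n : ℕ) (F : Set (Space d → ℂ)) : ℝ≥0∞ :=
  ⨆ f ∈ F, sectionError r n f

/-! The rest of this part is not used in the definitions above.  It checks that `fourierSection`
is the section of the Fourier integral. -/

/-- The open box `|λ_j| < σ_j`. -/
def box {d : ℕ} (σ : Fin d → ℝ) : Set (Space d) :=
  {l | ∀ j, |l j| < σ j}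

/-- The Fourier transform `(2π)^{-d/2} ∫ f(t) e^{-i(λ,t)} dt`. -/
def fourierTransform {d : ℕ} (f : Space d → ℂ) (l : Space d) : ℂ :=
  ((((2 * Real.pi) ^ (-(d : ℝ) / 2) : ℝ)) : ℂ) *
    ∫ t, f t * Complex.exp (-(Complex.I * (inner ℝ l t : ℝ)))

theorem integral_exp_Ioo (s t : ℝ) (hs : 0 < s) :
    ∫ l : ℝ, (Set.Ioo (-s) s).indicator (fun l => Complex.exp (Complex.I * ((l * t : ℝ) : ℂ))) l
      = ((2 * (s * Real.sinc (s * t)) : ℝ) : ℂ) := by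
  rw [integral_indicator measurableSet_Ioo, ← integral_Ioc_eq_integral_Ioo,
    ← intervalIntegral.integral_of_le (by linarith)]
  rcases eq_or_ne t 0 with rfl | ht
  · simp [Real.sinc_zero]; ring
  · have hc : Complex.I * (t : ℂ) ≠ 0 := by simp [ht]
    have := integral_exp_mul_complex (a := -s) (b := s) hc
    have h2 : (fun l : ℝ => Complex.exp (Complex.I * ((l * t : ℝ) : ℂ)))
        = fun l : ℝ => Complex.exp (Complex.I * (t : ℂ) * l) := by
      funext l; push_cast; congr 1; ring
    rw [h2, this, Real.sinc_of_ne_zero (mul_ne_zero hs.ne' ht)]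
    have e1 : Complex.I * (t : ℂ) * ((s : ℝ) : ℂ) = ((s * t : ℝ) : ℂ) * Complex.I := by
      push_cast; ring
    have e2 : Complex.I * (t : ℂ) * ((-s : ℝ) : ℂ) = ((-(s * t) : ℝ) : ℂ) * Complex.I := by
      push_cast; ring
    rw [e1, e2, Complex.exp_mul_I, Complex.exp_mul_I]
    rw [← Complex.ofReal_cos, ← Complex.ofReal_sin, ← Complex.ofReal_cos, ← Complex.ofReal_sin,
      Real.cos_neg, Real.sin_neg]
    have ht' : (t : ℂ) ≠ 0 := by exact_mod_cast ht
    have hs' : (s : ℂ) ≠ 0 := by exact_mod_cast hs.ne'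
    push_cast
    field_simp
    ring

theorem measurableSet_box {d : ℕ} (σ : Fin d → ℝ) : MeasurableSet (box σ) := by
  have : box σ = ⋂ j, {l : Space d | |l j| < σ j} := by ext; simp [box]
  rw [this]
  refine MeasurableSet.iInter fun j => ?_
  exact measurableSet_lt (by fun_prop) measurable_const

theorem volume_box_lt_top {d : ℕ} (σ : Fin d → ℝ) : volume (box σ) < ∞ := by
  have h : box σ = (@WithLp.ofLp 2 (Fin d → ℝ)) ⁻¹' (Set.univ.pi fun j => Set.Ioo (-σ j) (σ j)) := by
    ext l; simp [box, abs_lt]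
  rw [h, (PiLp.volume_preserving_ofLp (Fin d)).measure_preimage
    (MeasurableSet.univ_pi fun _ => measurableSet_Ioo).nullMeasurableSet, Real.volume_pi_Ioo]
  exact ENNReal.prod_lt_top fun _ _ => ENNReal.ofReal_lt_top

theorem integral_exp_box {d : ℕ} (σ : Fin d → ℝ) (hσ : ∀ j, 0 < σ j) (t : Space d) :
    ∫ l in box σ, Complex.exp (Complex.I * (inner ℝ l t : ℝ))
      = (((2 * Real.pi) ^ d * kernel σ t : ℝ) : ℂ) := by
  rw [← integral_indicator (measurableSet_box σ),
    ← (PiLp.volume_preserving_toLp (Fin d)).integral_comp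
      (MeasurableEquiv.toLp 2 (Fin d → ℝ)).measurableEmbedding]
  have h : ∀ l : Fin d → ℝ, (box σ).indicator
      (fun l : Space d => Complex.exp (Complex.I * (inner ℝ l t : ℝ))) (WithLp.toLp 2 l)
      = ∏ j, (Set.Ioo (-σ j) (σ j)).indicator
          (fun u : ℝ => Complex.exp (Complex.I * ((u * t j : ℝ) : ℂ))) (l j) := by
    intro l
    by_cases hl : ∀ j, |l j| < σ j
    · rw [Set.indicator_of_mem (by simpa [box] using hl)]
      rw [Finset.prod_congr rfl fun j _ => Set.indicator_of_mem
        (show l j ∈ Set.Ioo (-σ j) (σ j) from abs_lt.1 (hl j)) _]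
      rw [← Complex.exp_sum, PiLp.inner_apply]
      congr 1
      push_cast
      rw [Finset.mul_sum]
      refine Finset.sum_congr rfl fun j _ => ?_
      simp [mul_comm]
    · rw [Set.indicator_of_notMem (by simpa [box] using hl)]
      push Not at hl
      obtain ⟨j, hj⟩ := hl
      refine (Finset.prod_eq_zero (Finset.mem_univ j) ?_).symm
      refine Set.indicator_of_notMem (fun hm => ?_) _
      exact absurd (abs_lt.2 hm) (not_lt.2 hj)
  simp_rw [h]
  rw [integral_fintype_prod_volume_eq_prod (fun j (u : ℝ) => (Set.Ioo (-σ j) (σ j)).indicator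
          (fun u : ℝ => Complex.exp (Complex.I * ((u * t j : ℝ) : ℂ))) u)]
  simp_rw [integral_exp_Ioo _ _ (hσ _)]
  rw [← Complex.ofReal_prod, Finset.prod_mul_distrib, kernel]
  simp only [Finset.prod_const, Finset.card_univ, Fintype.card_fin]
  congr 1
  have : Real.pi ^ d ≠ 0 := by positivity
  rw [mul_pow]
  field_simp

/-- For integrable `f` the section is `(2π)^{-d/2} ∫_{|λ_j| < σ_j} (𝔉 f)(λ) e^{i(λ,x)} dλ`. -/
theorem fourierSection_eq_integral {d : ℕ} (σ : Fin d → ℝ) (hσ : ∀ j, 0 < σ j)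
    (f : Space d → ℂ) (hf : Integrable f volume) (x : Space d) :
    fourierSection σ f x = ((((2 * Real.pi) ^ (-(d : ℝ) / 2) : ℝ)) : ℂ) *
      ∫ l in box σ, fourierTransform f l * Complex.exp (Complex.I * (inner ℝ l x : ℝ)) := by
  have hfin : IsFiniteMeasure (volume.restrict (box σ)) :=
    ⟨by simpa using volume_box_lt_top σ⟩
  have key : ∫ l in box σ, ∫ y, f y * Complex.exp (Complex.I * (inner ℝ l (x - y) : ℝ))
      = ∫ y, ∫ l in box σ, f y * Complex.exp (Complex.I * (inner ℝ l (x - y) : ℝ)) := by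
    refine integral_integral_swap ?_
    have h1 : Integrable (fun z : Space d × Space d => f z.2)
        ((volume.restrict (box σ)).prod volume) := hf.comp_snd _
    refine h1.mul_bdd (c := 1) ?_ ?_
    · refine Continuous.aestronglyMeasurable ?_
      fun_prop
    · refine Filter.Eventually.of_forall fun z => ?_
      rw [mul_comm, Complex.norm_exp_ofReal_mul_I]
  have h2 : ((((2 * Real.pi) ^ (-(d : ℝ) / 2) : ℝ)) : ℂ) *
      ((((2 * Real.pi) ^ (-(d : ℝ) / 2) : ℝ)) : ℂ) * (((2 * Real.pi) ^ d : ℝ) : ℂ) = 1 := by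
    rw [← Complex.ofReal_mul, ← Complex.ofReal_mul, ← Real.rpow_natCast,
      ← Real.rpow_add (by positivity), ← Real.rpow_add (by positivity)]
    norm_num
  have h3 : ∀ y, ∫ l in box σ, f y * Complex.exp (Complex.I * (inner ℝ l (x - y) : ℝ))
      = (((2 * Real.pi) ^ d : ℝ) : ℂ) * (f y * (kernel σ (x - y) : ℂ)) := by
    intro y
    rw [integral_const_mul, integral_exp_box σ hσ]
    push_cast; ring
  have h4 : ∀ l : Space d, fourierTransform f l * Complex.exp (Complex.I * (inner ℝ l x : ℝ))
      = ((((2 * Real.pi) ^ (-(d : ℝ) / 2) : ℝ)) : ℂ) *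
        ∫ y, f y * Complex.exp (Complex.I * (inner ℝ l (x - y) : ℝ)) := by
    intro l
    rw [fourierTransform, mul_assoc, ← integral_mul_const]
    congr 2
    funext y
    rw [mul_assoc, ← Complex.exp_add, inner_sub_right]
    push_cast
    ring_nf
  simp_rw [h4]
  rw [integral_const_mul, key]
  simp_rw [h3]
  rw [integral_const_mul, ← mul_assoc, ← mul_assoc, h2, one_mul, fourierSection]

theorem continuous_kernel {d : ℕ} (σ : Fin d → ℝ) : Continuous (kernel σ) := by
  unfold kernel
  have := Real.continuous_sinc
  fun_prop

theorem abs_sinc_le (u : ℝ) : |Real.sinc u| ≤ 2 * (1 + |u|)⁻¹ := by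
  have h0 : 0 < 1 + |u| := by positivity
  rw [← div_eq_mul_inv, le_div_iff₀ h0]
  have h1 : |Real.sinc u| ≤ 1 := Real.abs_sinc_le_one u
  have h2 : |Real.sinc u| * |u| ≤ 1 := by
    rcases eq_or_ne u 0 with rfl | hu
    · simp
    · rw [Real.sinc_of_ne_zero hu, abs_div, div_mul_cancel₀ _ (abs_ne_zero.2 hu)]
      exact Real.abs_sin_le_one u
  linarith

theorem integrable_kernel_rpow {d : ℕ} (σ : Fin d → ℝ) (hσ : ∀ j, 0 < σ j) (q : ℝ) (hq : 1 < q) :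
    Integrable (fun t : Space d => |kernel σ t| ^ q) volume := by
  have h1 : ∀ j, Integrable (fun u : ℝ => |σ j * Real.sinc (σ j * u)| ^ q) volume := by
    intro j
    have hb : Integrable (fun u : ℝ => (1 + ‖u‖) ^ (-q)) volume :=
      integrable_one_add_norm (by simpa using hq)
    have hb2 : Integrable (fun u : ℝ => (σ j * 2) ^ q * (1 + ‖σ j * u‖) ^ (-q)) volume :=
      (hb.comp_mul_left' (hσ j).ne').const_mul _
    refine hb2.mono' ?_ ?_
    · refine Continuous.aestronglyMeasurable ?_
      have := Real.continuous_sinc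
      exact Continuous.rpow_const (by fun_prop) fun _ => Or.inr (by linarith)
    · refine Filter.Eventually.of_forall fun u => ?_
      have hp := hσ j
      rw [Real.norm_of_nonneg (by positivity), Real.rpow_neg (by positivity),
        ← Real.inv_rpow (by positivity), ← Real.mul_rpow (by positivity) (by positivity)]
      refine Real.rpow_le_rpow (by positivity) ?_ (by linarith)
      rw [abs_mul, abs_of_pos hp, mul_assoc]
      exact mul_le_mul_of_nonneg_left (abs_sinc_le _) hp.le
  have h2 : Integrable (fun t : Fin d → ℝ => ∏ j, |σ j * Real.sinc (σ j * t j)| ^ q) volume :=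
    Integrable.fintype_prod (f := fun j (u : ℝ) => |σ j * Real.sinc (σ j * u)| ^ q) h1
  have h3 := (((PiLp.volume_preserving_ofLp (Fin d)).integrable_comp_emb
    (MeasurableEquiv.toLp 2 (Fin d → ℝ)).symm.measurableEmbedding).2 h2).const_mul
      (|(Real.pi ^ d)⁻¹| ^ q)
  refine h3.congr (Filter.Eventually.of_forall fun t => ?_)
  simp only [Function.comp, kernel]
  rw [abs_mul, Real.mul_rpow (abs_nonneg _) (abs_nonneg _), Finset.abs_prod,
    Real.finsetProd_rpow _ _ fun _ _ => abs_nonneg _]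

/-- For `f ∈ L_p` the integral that defines the section converges absolutely. -/
theorem integrable_mul_kernel {d : ℕ} (σ : Fin d → ℝ) (hσ : ∀ j, 0 < σ j) (p : ℝ) (hp : 1 < p)
    (f : Space d → ℂ) (hf : MemLp f (ENNReal.ofReal p) volume) (x : Space d) :
    Integrable (fun y => f y * (kernel σ (x - y) : ℂ)) volume := by
  have hpq := Real.HolderConjugate.conjExponent hp
  set q := p.conjExponent
  have hk : MemLp (fun y => (kernel σ (x - y) : ℂ)) (ENNReal.ofReal q) volume := by
    have hc : Continuous (fun y => (kernel σ (x - y) : ℂ)) := by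
      have := continuous_kernel σ
      fun_prop
    rw [← integrable_norm_rpow_iff hc.aestronglyMeasurable (by simpa using hpq.symm.pos)
      ENNReal.ofReal_ne_top, ENNReal.toReal_ofReal hpq.symm.nonneg]
    simpa using (integrable_kernel_rpow σ hσ q hpq.symm.lt).comp_sub_left x
  have := hpq.ennrealOfReal
  exact hf.integrable_mul hk

theorem fourierTransform_schwartz {d : ℕ} (φ : SchwartzMap (Space d) ℂ) (l : Space d) :
    fourierTransform φ l = ((((2 * Real.pi) ^ (-(d : ℝ) / 2) : ℝ)) : ℂ) *
      FourierTransform.fourier φ ((2 * Real.pi)⁻¹ • l) := by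
  rw [fourierTransform, SchwartzMap.fourier_coe, Real.fourier_eq']
  congr 2
  funext t
  rw [smul_eq_mul, mul_comm, real_inner_comm, real_inner_smul_right]
  congr 2
  have : (Real.pi : ℂ) ≠ 0 := by exact_mod_cast Real.pi_ne_zero
  push_cast
  field_simp

theorem integrable_fourierTransform_schwartz {d : ℕ} (φ : SchwartzMap (Space d) ℂ) :
    Integrable (fourierTransform φ) volume := by
  have h := ((FourierTransform.fourier φ).integrable (μ := volume)).comp_smul
    (inv_ne_zero (mul_ne_zero two_ne_zero Real.pi_ne_zero) : (2 * Real.pi)⁻¹ ≠ 0)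
  have := h.const_mul ((((2 * Real.pi) ^ (-(d : ℝ) / 2) : ℝ)) : ℂ)
  refine this.congr (Filter.Eventually.of_forall fun l => ?_)
  simp only [fourierTransform_schwartz]

theorem fourierTransform_fourierTransform {d : ℕ} (φ : SchwartzMap (Space d) ℂ) (l : Space d) :
    fourierTransform (fourierTransform φ) l = φ (-l) := by
  have hπ : (0 : ℝ) < 2 * Real.pi := by positivity
  have hinv : φ (-l) = FourierTransformInv.fourierInv (FourierTransform.fourier φ) (-l) := by
    rw [FourierTransform.fourierInv_fourier_eq]
  rw [hinv, SchwartzMap.fourierInv_coe, Real.fourierInv_eq', fourierTransform]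
  have h1 : ∀ t : Space d, fourierTransform φ t * Complex.exp (-(Complex.I * (inner ℝ l t : ℝ)))
      = ((((2 * Real.pi) ^ (-(d : ℝ) / 2) : ℝ)) : ℂ) *
        (fun v : Space d => Complex.exp (((2 * Real.pi * inner ℝ v (-l) : ℝ) : ℂ) * Complex.I) •
          FourierTransform.fourier φ v) ((2 * Real.pi)⁻¹ • t) := by
    intro t
    beta_reduce
    rw [fourierTransform_schwartz, smul_eq_mul, inner_neg_right, real_inner_smul_left,
      real_inner_comm l t]
    have : (Real.pi : ℂ) ≠ 0 := by exact_mod_cast Real.pi_ne_zero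
    have e : -(Complex.I * ((inner ℝ l t : ℝ) : ℂ)) =
        ((2 * Real.pi * -((2 * Real.pi)⁻¹ * inner ℝ l t) : ℝ) : ℂ) * Complex.I := by
      push_cast
      field_simp
    rw [e]
    ring
  rw [integral_congr_ae (Filter.Eventually.of_forall h1)]
  rw [integral_const_mul, Measure.integral_comp_smul volume
    (fun v : Space d => Complex.exp (((2 * Real.pi * inner ℝ v (-l) : ℝ) : ℂ) * Complex.I) •
      FourierTransform.fourier φ v)]
  have h2 : ((((2 * Real.pi) ^ (-(d : ℝ) / 2) : ℝ)) : ℂ) *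
      ((((2 * Real.pi) ^ (-(d : ℝ) / 2) : ℝ)) : ℂ) * (((2 * Real.pi) ^ d : ℝ) : ℂ) = 1 := by
    rw [← Complex.ofReal_mul, ← Complex.ofReal_mul, ← Real.rpow_natCast,
      ← Real.rpow_add (by positivity), ← Real.rpow_add (by positivity)]
    norm_num
  have h3 : |(((2 * Real.pi)⁻¹ ^ Module.finrank ℝ (Space d))⁻¹ : ℝ)| = (2 * Real.pi) ^ d := by
    rw [finrank_euclideanSpace_fin, inv_pow, inv_inv, abs_of_pos (by positivity)]
  rw [h3, Complex.real_smul, ← mul_assoc, ← mul_assoc, h2, one_mul]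

/-- For every `f ∈ L_p`, `1 < p < ∞`, the section `S_σ f` satisfies
`⟨S_σ f, 𝔉 φ⟩ = ⟨f, 𝔉 (χ φ)⟩` for all Schwartz functions `φ`, where `χ` is the indicator function of
the box `|λ_j| < σ_j`.  That is, in the sense of tempered distributions, the Fourier transform
of `S_σ f` is the product of `χ` and the Fourier transform of `f`. -/
theorem integral_fourierSection_mul {d : ℕ} (σ : Fin d → ℝ) (hσ : ∀ j, 0 < σ j) (p : ℝ)
    (hp : 1 < p) (f : Space d → ℂ) (hf : MemLp f (ENNReal.ofReal p) volume)
    (φ : SchwartzMap (Space d) ℂ) :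
    ∫ x, fourierSection σ f x * fourierTransform φ x
      = ∫ y, f y * fourierTransform ((box σ).indicator φ) y := by
  have hφ := integrable_fourierTransform_schwartz φ
  have hsec : ∀ y, ∫ x, fourierTransform φ x * (kernel σ (y - x) : ℂ)
      = fourierTransform ((box σ).indicator φ) y := by
    intro y
    have h := fourierSection_eq_integral σ hσ _ hφ y
    rw [fourierSection] at h
    rw [h, fourierTransform]
    congr 1
    simp_rw [fourierTransform_fourierTransform]
    rw [← integral_indicator (measurableSet_box σ), ← integral_neg_eq_self]
    congr 1
    funext l
    have hm : -l ∈ box σ ↔ l ∈ box σ := by simp [box]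
    by_cases hl : l ∈ box σ
    · rw [Set.indicator_of_mem (hm.2 hl), Set.indicator_of_mem hl, neg_neg, inner_neg_left,
        real_inner_comm]
      push_cast
      rw [mul_neg]
    · rw [Set.indicator_of_notMem (mt hm.1 hl), Set.indicator_of_notMem hl, zero_mul]
  have heven : ∀ t : Space d, kernel σ (-t) = kernel σ t := by
    intro t
    simp [kernel, Real.sinc_neg]
  have hpq := Real.HolderConjugate.conjExponent hp
  set q := p.conjExponent
  have hint : Integrable (Function.uncurry fun x y : Space d =>
      f y * (kernel σ (x - y) : ℂ) * fourierTransform φ x) (volume.prod volume) := by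
    have hm : AEStronglyMeasurable (Function.uncurry fun x y : Space d =>
        f y * (kernel σ (x - y) : ℂ) * fourierTransform φ x) (volume.prod volume) := by
      refine (hf.1.comp_snd.mul ?_).mul hφ.1.comp_fst
      have := continuous_kernel σ
      exact Continuous.aestronglyMeasurable (by fun_prop)
    rw [integrable_prod_iff hm]
    constructor
    · refine Filter.Eventually.of_forall fun x => ?_
      simp only [Function.uncurry]
      exact (integrable_mul_kernel σ hσ p hp f hf x).mul_const (fourierTransform φ x)
    have hB : ∀ x, ∫ y, ‖f y‖ * |kernel σ (x - y)| ≤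
        (∫ y, ‖f y‖ ^ p) ^ (1 / p) * (∫ y, |kernel σ y| ^ q) ^ (1 / q) := by
      intro x
      have hk : MemLp (fun y => |kernel σ (x - y)|) (ENNReal.ofReal q) volume := by
        have hc : Continuous (fun y => |kernel σ (x - y)|) := by
          have := continuous_kernel σ
          fun_prop
        rw [← integrable_norm_rpow_iff hc.aestronglyMeasurable (by simpa using hpq.symm.pos)
          ENNReal.ofReal_ne_top, ENNReal.toReal_ofReal hpq.symm.nonneg]
        simpa using (integrable_kernel_rpow σ hσ q hpq.symm.lt).comp_sub_left x
      have h := integral_mul_le_Lp_mul_Lq_of_nonneg (μ := volume) hpq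
        (f := fun y => ‖f y‖) (g := fun y => |kernel σ (x - y)|)
        (Filter.Eventually.of_forall fun y => norm_nonneg _)
        (Filter.Eventually.of_forall fun y => abs_nonneg _) hf.norm hk
      rwa [integral_sub_left_eq_self (fun y => |kernel σ y| ^ q) volume x] at h
    refine (hφ.norm.const_mul ((∫ y, ‖f y‖ ^ p) ^ (1 / p) *
      (∫ y, |kernel σ y| ^ q) ^ (1 / q))).mono' hm.norm.integral_prod_right' ?_
    refine Filter.Eventually.of_forall fun x => ?_
    rw [Real.norm_of_nonneg (integral_nonneg fun _ => norm_nonneg _)]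
    simp only [Function.uncurry, norm_mul, Complex.norm_real, Real.norm_eq_abs]
    rw [integral_mul_const]
    exact mul_le_mul_of_nonneg_right (hB x) (norm_nonneg _)
  calc ∫ x, fourierSection σ f x * fourierTransform φ x
      = ∫ x, ∫ y, f y * (kernel σ (x - y) : ℂ) * fourierTransform φ x := by
        congr 1; funext x; rw [fourierSection, integral_mul_const]
    _ = ∫ y, ∫ x, f y * (kernel σ (x - y) : ℂ) * fourierTransform φ x :=
        integral_integral_swap hint
    _ = ∫ y, f y * fourierTransform ((box σ).indicator φ) y := by
        congr 1; funext y
        rw [← hsec y, ← integral_const_mul]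
        congr 1; funext x
        rw [← heven (x - y), neg_sub]
        ring

end

end NikolskiiBesov

open NikolskiiBesov

/-!
The upper bound rests on Nikol'skii's inequality for the layers. Fix a smooth symbol with compact
support which is `1` on the unit box, and let `U` be its inverse Fourier transform
(`exists_isLowPass`). The symbol dilated to the box of scale `s` acts as the average
`h ↦ ∫ U(v) h(x - M v) dv` with `M = 2π a^{-s}`, and it does not change the layer `f_{a^s}`, whose
spectrum lies in that box (`layer_ae_eq_smoothing`). Hölder's inequality and the determinant
`(2π)^d 2^{-d s}` of `M` then give `‖f_{a^s}‖_∞ ≤ K 2^{s d / p} ‖f_{a^s}‖_p`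
(`exists_norm_layer_le`). In the class the right-hand side is at most `K 2^{-s (g(r) - d / p)}`, a
convergent geometric series. Finiteness of `‖f_{a^s}‖_p` is part of membership in the class, so
the boundedness of `S_σ` on `L_p` is not needed.

It remains to see that the layers sum up to `f` (`ae_eq_of_tendsto_fourierSection`). The sections
`S_{a^m} f` converge uniformly to some bounded `G`. The average of `f` at a fixed scale agrees, as a
distribution, with the average of `S_{a^m} f` for all large `m`, because the box of `a^m` then
contains the support of the symbol; hence it agrees with the average of `G`. As the scale of the
averages tends to infinity, they converge weakly to `f` and to `G`, so `f = G` almost everywhere.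

For the lower bound let `H` be a Schwartz function whose symbol is supported in the unit box and off
the box of size `a^{-1}`. The function `H(a^n x)` has `n`-th layer equal to itself and all other
layers zero, and `S_{a^{n-1}}` annihilates it. Normalised in the class, it has uniform norm
`c 2^{-n (g(r) - d / p)}` by scaling (`exists_le_classError`).
-/

namespace NikolskiiBesov
open Filter Topology
open scoped SchwartzMap ContDiff FourierTransform

noncomputable section

variable {d : ℕ}

/-! ### Anisotropic dilations -/

/-- The anisotropic dilation `x ↦ (c_1 x_1, …, c_d x_d)` of `ℝ^d`. -/
def dilation (c : Fin d → ℝ) : Space d →L[ℝ] Space d :=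
  LinearMap.toContinuousLinearMap
    { toFun := fun x => WithLp.toLp 2 fun j => c j * x j
      map_add' := fun x y => by ext j; simp [mul_add]
      map_smul' := fun a x => by ext j; simp; ring }

@[simp]
theorem dilation_apply (c : Fin d → ℝ) (x : Space d) (j : Fin d) :
    dilation c x j = c j * x j := rfl

theorem inner_dilation_left (c : Fin d → ℝ) (x y : Space d) :
    inner ℝ (dilation c x) y = inner ℝ x (dilation c y) := by
  simp only [PiLp.inner_apply, dilation_apply, RCLike.inner_apply, conj_trivial]
  exact Finset.sum_congr rfl fun j _ => by ring

theorem det_dilation (c : Fin d → ℝ) :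
    LinearMap.det (dilation c : Space d →ₗ[ℝ] Space d) = ∏ j, c j := by
  rw [← LinearMap.det_toMatrix (EuclideanSpace.basisFun (Fin d) ℝ).toBasis,
    ← Matrix.det_diagonal]
  congr 1
  ext i j
  rw [LinearMap.toMatrix_apply, Matrix.diagonal_apply]
  by_cases h : i = j
  · subst h; simp
  · simp [h]

theorem map_dilation_volume (c : Fin d → ℝ) (hc : ∀ j, 0 < c j) :
    Measure.map (dilation c) (volume : Measure (Space d))
      = ENNReal.ofReal (∏ j, c j)⁻¹ • volume := by
  have hp : 0 < ∏ j, c j := Finset.prod_pos fun j _ => hc j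
  have h := Measure.map_linearMap_addHaar_eq_smul_addHaar (volume : Measure (Space d))
    (f := (dilation c : Space d →ₗ[ℝ] Space d)) (by rw [det_dilation]; exact hp.ne')
  rw [det_dilation, abs_of_pos (inv_pos.2 hp)] at h
  exact h

theorem dilation_inv_dilation (c : Fin d → ℝ) (hc : ∀ j, 0 < c j) (x : Space d) :
    dilation (fun j => (c j)⁻¹) (dilation c x) = x := by
  ext j
  simp [inv_mul_cancel_left₀ (hc j).ne']

theorem measurableEmbedding_dilation (c : Fin d → ℝ) (hc : ∀ j, 0 < c j) :
    MeasurableEmbedding (dilation c) :=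
  (dilation c).continuous.measurableEmbedding
    (Function.LeftInverse.injective (dilation_inv_dilation c hc))

theorem eLpNorm_comp_dilation (c : Fin d → ℝ) (hc : ∀ j, 0 < c j) (h : Space d → ℂ) (p : ℝ≥0∞) :
    eLpNorm (fun x => h (dilation c x)) p volume
      = ENNReal.ofReal ((∏ j, c j)⁻¹) ^ (1 / p).toReal * eLpNorm h p volume := by
  have hp : 0 < ∏ j, c j := Finset.prod_pos fun j _ => hc j
  change eLpNorm (h ∘ dilation c) p volume = _
  rw [← (measurableEmbedding_dilation c hc).eLpNorm_map_measure, map_dilation_volume c hc,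
    eLpNorm_smul_measure_of_ne_zero (by simpa using hp), smul_eq_mul]

theorem memLp_comp_dilation (c : Fin d → ℝ) (hc : ∀ j, 0 < c j) {h : Space d → ℂ} {p : ℝ≥0∞}
    (hh : MemLp h p volume) : MemLp (fun x => h (dilation c x)) p volume := by
  change MemLp (h ∘ dilation c) p volume
  rw [← (measurableEmbedding_dilation c hc).memLp_map_measure_iff, map_dilation_volume c hc]
  exact hh.smul_measure ENNReal.ofReal_ne_top

theorem integral_comp_dilation (c : Fin d → ℝ) (hc : ∀ j, 0 < c j) (h : Space d → ℂ) :
    ∫ x, h (dilation c x) = ((∏ j, c j)⁻¹ : ℝ) * ∫ x, h x := by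
  have hp : 0 < ∏ j, c j := Finset.prod_pos fun j _ => hc j
  rw [← (measurableEmbedding_dilation c hc).integral_map, map_dilation_volume c hc,
    integral_smul_measure, ENNReal.toReal_ofReal (inv_pos.2 hp).le, Complex.real_smul]

/-! ### Fourier transforms of Schwartz functions -/

/-- `fourierTransform` as a map of the Schwartz space into itself. -/
def schwartzFourier (φ : 𝓢(Space d, ℂ)) : 𝓢(Space d, ℂ) :=
  ((((2 * Real.pi) ^ (-(d : ℝ) / 2) : ℝ)) : ℂ) •
    SchwartzMap.compCLMOfContinuousLinearEquiv ℂ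
      (ContinuousLinearEquiv.smulLeft (Units.mk0 ((2 * Real.pi)⁻¹ : ℝ) (by positivity)))
      (𝓕 φ)

theorem coe_schwartzFourier (φ : 𝓢(Space d, ℂ)) :
    ⇑(schwartzFourier φ) = fourierTransform φ := by
  ext l
  rw [fourierTransform_schwartz]
  rfl

theorem exists_fourierTransform_eq (Φ : 𝓢(Space d, ℂ)) :
    ∃ φ : 𝓢(Space d, ℂ), fourierTransform φ = Φ := by
  refine ⟨schwartzFourier (schwartzFourier (schwartzFourier Φ)), ?_⟩
  ext l
  rw [coe_schwartzFourier, fourierTransform_fourierTransform, coe_schwartzFourier,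
    coe_schwartzFourier, fourierTransform_fourierTransform, neg_neg]

/-- Multiplication by `λ ↦ 𝓕 U (c λ)` on the side of the Fourier transform is averaging over
translates with the weight `U`. -/
theorem fourierTransform_fourier_dilation_mul (U φ : 𝓢(Space d, ℂ)) (c : Fin d → ℝ) (x : Space d) :
    fourierTransform (fun l => 𝓕 U (dilation c l) * φ l) x
      = ∫ v, U v * fourierTransform φ (x + dilation (fun j => 2 * Real.pi * c j) v) := by
  set k : ℂ := ((((2 * Real.pi) ^ (-(d : ℝ) / 2) : ℝ)) : ℂ) with hk
  set M := dilation (fun j => 2 * Real.pi * c j) with hM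
  have hMv : ∀ v l : Space d, 2 * Real.pi * inner ℝ v (dilation c l) = inner ℝ (M v) l := by
    intro v l
    rw [hM, inner_dilation_left]
    simp only [PiLp.inner_apply, dilation_apply, RCLike.inner_apply, conj_trivial, Finset.mul_sum]
    exact Finset.sum_congr rfl fun j _ => by ring
  have e : ∀ v l : Space d, Complex.exp (((-2 * Real.pi * inner ℝ v (dilation c l) : ℝ) : ℂ) *
      Complex.I) * Complex.exp (-(Complex.I * (inner ℝ x l : ℝ)))
      = Complex.exp (-(Complex.I * (inner ℝ (x + M v) l : ℝ))) := by
    intro v l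
    rw [← Complex.exp_add, inner_add_left, ← hMv]
    congr 1
    push_cast
    ring
  have hint : Integrable (Function.uncurry fun l v : Space d =>
      k * (U v * φ l * Complex.exp (-(Complex.I * (inner ℝ (x + M v) l : ℝ)))))
      (volume.prod volume) := by
    refine Integrable.const_mul ?_ _
    have h1 : Integrable (fun z : Space d × Space d => U z.2 * φ z.1) (volume.prod volume) := by
      refine (φ.integrable.mul_prod U.integrable).congr (Eventually.of_forall fun z => ?_)
      exact mul_comm _ _
    refine h1.mul_bdd (c := 1) ?_ ?_
    · exact Continuous.aestronglyMeasurable (by fun_prop)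
    · refine Eventually.of_forall fun z => ?_
      rw [← mul_neg, ← Complex.ofReal_neg, mul_comm, Complex.norm_exp_ofReal_mul_I]
  calc fourierTransform (fun l => 𝓕 U (dilation c l) * φ l) x
      = ∫ l, ∫ v, k * (U v * φ l *
          Complex.exp (-(Complex.I * (inner ℝ (x + M v) l : ℝ)))) := by
        rw [fourierTransform, ← hk, ← integral_const_mul]
        congr 1; funext l
        rw [SchwartzMap.fourier_coe, Real.fourier_eq', ← integral_mul_const, ← integral_mul_const,
          ← integral_const_mul]
        congr 1; funext v
        rw [← e, smul_eq_mul]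
        push_cast
        ring
    _ = ∫ v, ∫ l, k * (U v * φ l *
          Complex.exp (-(Complex.I * (inner ℝ (x + M v) l : ℝ)))) := integral_integral_swap hint
    _ = _ := by
        congr 1; funext v
        rw [fourierTransform, ← hk, mul_left_comm, ← integral_const_mul, ← integral_const_mul]
        congr 1; funext l
        ring

/-- The section of `fourierTransform φ` truncates `φ`, which is called the symbol of
`fourierTransform φ`. The Fourier transform of the latter is `φ(-λ)`, and the box is symmetric. -/
theorem fourierSection_fourierTransform (σ : Fin d → ℝ) (hσ : ∀ j, 0 < σ j) (φ : 𝓢(Space d, ℂ)) :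
    fourierSection σ (fourierTransform φ) = fourierTransform ((box σ).indicator φ) := by
  funext y
  rw [fourierSection_eq_integral σ hσ _ (integrable_fourierTransform_schwartz φ) y,
    fourierTransform]
  congr 1
  simp_rw [fourierTransform_fourierTransform]
  rw [← integral_indicator (measurableSet_box σ), ← integral_neg_eq_self]
  congr 1
  funext l
  have hm : -l ∈ box σ ↔ l ∈ box σ := by simp [box]
  by_cases hl : l ∈ box σ
  · rw [Set.indicator_of_mem (hm.2 hl), Set.indicator_of_mem hl, neg_neg, inner_neg_left,
      real_inner_comm]
    push_cast
    rw [mul_neg]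
  · rw [Set.indicator_of_notMem (mt hm.1 hl), Set.indicator_of_notMem hl, zero_mul]

/-! ### Averages over translates -/

/-- The average `x ↦ ∫ U(v) h(x - M v) dv` of the translates of `h`, with a weight `U`. -/
def smoothing (U : 𝓢(Space d, ℂ)) (M : Space d →L[ℝ] Space d) (h : Space d → ℂ) (x : Space d) : ℂ :=
  ∫ v, U v * h (x - M v)

theorem integral_norm_mul_le {p q : ℝ≥0∞} [ENNReal.HolderConjugate p q] {h k : Space d → ℂ}
    (hh : MemLp h p volume) (hk : MemLp k q volume) :
    ∫ x, ‖h x * k x‖ ≤ (eLpNorm h p volume).toReal * (eLpNorm k q volume).toReal := by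
  have h1 : eLpNorm (fun x => h x * k x) 1 volume ≤ eLpNorm h p volume * eLpNorm k q volume := by
    simpa using eLpNorm_le_eLpNorm_mul_eLpNorm'_of_norm (p := p) (q := q) (r := 1) hh.1 hk.1
      (fun a b => a * b) 1 (Eventually.of_forall fun x => by simp)
  have hm : AEStronglyMeasurable (fun x => h x * k x) volume := hh.1.mul hk.1
  rw [integral_norm_eq_lintegral_enorm hm, ← eLpNorm_one_eq_lintegral_enorm,
    ← ENNReal.toReal_mul]
  exact ENNReal.toReal_mono (ENNReal.mul_ne_top hh.2.ne hk.2.ne) h1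

theorem memLp_comp_add_right {q : ℝ≥0∞} {k : Space d → ℂ} (hk : MemLp k q volume) (z : Space d) :
    MemLp (fun x => k (x + z)) q volume :=
  hk.comp_measurePreserving (measurePreserving_add_right volume z)

theorem eLpNorm_comp_add_right {q : ℝ≥0∞} {k : Space d → ℂ} (hk : MemLp k q volume) (z : Space d) :
    eLpNorm (fun x => k (x + z)) q volume = eLpNorm k q volume :=
  eLpNorm_comp_measurePreserving hk.1 (measurePreserving_add_right volume z)

theorem integrable_mul_smoothing_kernel {p q : ℝ≥0∞} [ENNReal.HolderConjugate p q]
    (U : 𝓢(Space d, ℂ)) (M : Space d →L[ℝ] Space d) {h k : Space d → ℂ}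
    (hh : MemLp h p volume) (hk : MemLp k q volume) (hkc : Continuous k) :
    Integrable (Function.uncurry fun x v : Space d => h x * (U v * k (x + M v)))
      (volume.prod volume) := by
  have hm : AEStronglyMeasurable (Function.uncurry fun x v : Space d =>
      h x * (U v * k (x + M v))) (volume.prod volume) := by
    refine hh.1.comp_fst.mul ?_
    exact Continuous.aestronglyMeasurable (by fun_prop)
  have e : ∀ v x, h x * (U v * k (x + M v)) = U v * (h x * k (x + M v)) := fun v x => by ring
  rw [integrable_prod_iff' hm]
  constructor
  · refine Eventually.of_forall fun v => ?_
    simp only [Function.uncurry, e]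
    exact (hh.integrable_mul (memLp_comp_add_right hk (M v))).const_mul _
  · refine (U.integrable.norm.mul_const ((eLpNorm h p volume).toReal *
      (eLpNorm k q volume).toReal)).mono' hm.norm.prod_swap.integral_prod_right' ?_
    refine Eventually.of_forall fun v => ?_
    rw [Real.norm_of_nonneg (integral_nonneg fun _ => norm_nonneg _)]
    simp only [Function.uncurry, e, norm_mul (U v)]
    rw [integral_const_mul]
    refine mul_le_mul_of_nonneg_left ?_ (norm_nonneg _)
    have := integral_norm_mul_le hh (memLp_comp_add_right hk (M v))
    rwa [eLpNorm_comp_add_right hk] at this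

theorem integral_mul_integral_eq_integral_mul_integral {p q : ℝ≥0∞} [ENNReal.HolderConjugate p q]
    (U : 𝓢(Space d, ℂ)) (M : Space d →L[ℝ] Space d) {h k : Space d → ℂ}
    (hh : MemLp h p volume) (hk : MemLp k q volume) (hkc : Continuous k) :
    ∫ x, h x * ∫ v, U v * k (x + M v) = ∫ v, U v * ∫ x, h x * k (x + M v) := by
  simp_rw [← integral_const_mul]
  rw [integral_integral_swap (integrable_mul_smoothing_kernel U M hh hk hkc)]
  congr 1; funext v; congr 1; funext x; ring

/-- The transpose of averaging is averaging over the opposite translates. -/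
theorem integral_mul_integral_eq_integral_smoothing_mul {p q : ℝ≥0∞} [ENNReal.HolderConjugate p q]
    (U : 𝓢(Space d, ℂ)) (M : Space d →L[ℝ] Space d) {h k : Space d → ℂ}
    (hh : MemLp h p volume) (hk : MemLp k q volume) (hkc : Continuous k) :
    ∫ x, h x * ∫ v, U v * k (x + M v) = ∫ x, smoothing U M h x * k x := by
  have hmp : MeasurePreserving (fun z : Space d × Space d => (z.1, z.2 - M z.1))
      (volume.prod volume) (volume.prod volume) := by
    refine (MeasurePreserving.id volume).skew_product (g := fun v x => x - M v) (by fun_prop) ?_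
    exact Eventually.of_forall fun v => (measurePreserving_sub_right volume (M v)).map_eq
  have h1 := integrable_mul_smoothing_kernel U M hh hk hkc
  have h2 : Integrable (Function.uncurry fun v x : Space d => U v * h (x - M v) * k x)
      (volume.prod volume) := by
    refine (hmp.integrable_comp_of_integrable h1.swap).congr (Eventually.of_forall fun z => ?_)
    simp [Function.uncurry]
    ring
  rw [integral_mul_integral_eq_integral_mul_integral U M hh hk hkc]
  calc ∫ v, U v * ∫ x, h x * k (x + M v)
      = ∫ v, ∫ x, U v * h (x - M v) * k x := by
        congr 1; funext v
        rw [← integral_const_mul, ← integral_sub_right_eq_self _ (M v)]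
        congr 1; funext x
        rw [sub_add_cancel]; ring
    _ = ∫ x, ∫ v, U v * h (x - M v) * k x := integral_integral_swap h2
    _ = _ := by
        congr 1; funext x
        rw [smoothing, integral_mul_const]

/-! ### Smooth multipliers and sections -/

theorem memLp_kernel (σ : Fin d → ℝ) (hσ : ∀ j, 0 < σ j) (q : ℝ) (hq : 1 < q) :
    MemLp (fun y => (kernel σ y : ℂ)) (ENNReal.ofReal q) volume := by
  have hc : Continuous (fun y => (kernel σ y : ℂ)) := by
    have := continuous_kernel σ
    fun_prop
  rw [← integrable_norm_rpow_iff hc.aestronglyMeasurable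
    (by simpa using zero_lt_one.trans hq) ENNReal.ofReal_ne_top,
    ENNReal.toReal_ofReal (zero_lt_one.trans hq).le]
  simpa using integrable_kernel_rpow σ hσ q hq

theorem aestronglyMeasurable_fourierSection (σ : Fin d → ℝ) {f : Space d → ℂ}
    (hf : AEStronglyMeasurable f volume) :
    AEStronglyMeasurable (fourierSection σ f) volume := by
  have hm : AEStronglyMeasurable (fun z : Space d × Space d =>
      f z.2 * (kernel σ (z.1 - z.2) : ℂ)) (volume.prod volume) := by
    refine hf.comp_snd.mul ?_
    have := continuous_kernel σ
    exact Continuous.aestronglyMeasurable (by fun_prop)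
  exact hm.integral_prod_right'

theorem memLp_top_fourierSection (σ : Fin d → ℝ) (hσ : ∀ j, 0 < σ j) (p : ℝ) (hp : 1 < p)
    {f : Space d → ℂ} (hf : MemLp f (ENNReal.ofReal p) volume) :
    MemLp (fourierSection σ f) ∞ volume := by
  have hpq := Real.HolderConjugate.conjExponent hp
  have := hpq.ennrealOfReal
  have hk := memLp_kernel σ hσ _ hpq.symm.lt
  refine memLp_top_of_bound (aestronglyMeasurable_fourierSection σ hf.1)
    ((eLpNorm f (ENNReal.ofReal p) volume).toReal *
      (eLpNorm (fun y => (kernel σ y : ℂ)) (ENNReal.ofReal p.conjExponent) volume).toReal)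
    (Eventually.of_forall fun x => ?_)
  have hmp := Measure.measurePreserving_sub_left (volume : Measure (Space d)) x
  have h := integral_norm_mul_le hf (hk.comp_measurePreserving hmp)
  rw [eLpNorm_comp_measurePreserving hk.1 hmp] at h
  exact (norm_integral_le_integral_norm _).trans h

theorem hasTemperateGrowth_fourier_dilation (U : 𝓢(Space d, ℂ)) (c : Fin d → ℝ) :
    Function.HasTemperateGrowth (fun l => 𝓕 U (dilation c l)) :=
  (𝓕 U).hasTemperateGrowth.comp (dilation c).hasTemperateGrowth

/-- The weight `U` is a low-pass filter if its Fourier transform is `1` on the unit box and vanishes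
outside the box of size `R`. -/
structure IsLowPass (U : 𝓢(Space d, ℂ)) (R : ℝ) : Prop where
  eq_one : ∀ l, (∀ j, |l j| < 1) → 𝓕 U l = 1
  lt_of_ne_zero : ∀ l, 𝓕 U l ≠ 0 → ∀ j, |l j| < R

theorem exists_isLowPass (d : ℕ) : ∃ (U : 𝓢(Space d, ℂ)) (R : ℝ), IsLowPass U R := by
  -- the unit box lies in the ball of radius `√d ≤ d + 1`
  let b : ContDiffBump (0 : Space d) := ⟨d + 1, d + 2, by positivity, by linarith⟩
  have hs : HasCompactSupport (fun l => (b l : ℂ)) :=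
    b.hasCompactSupport.comp_left (g := fun t : ℝ => (t : ℂ)) (by simp)
  have hd : ContDiff ℝ ∞ (fun l => (b l : ℂ)) := Complex.ofRealCLM.contDiff.comp b.contDiff
  refine ⟨𝓕⁻ (hs.toSchwartzMap hd), d + 2, ?_, ?_⟩
  · intro l hl
    have hn : ‖l‖ ≤ d + 1 := by
      rw [EuclideanSpace.norm_eq]
      refine Real.sqrt_le_iff.2 ⟨by positivity, ?_⟩
      have h1 : ∑ j, ‖l j‖ ^ 2 ≤ ∑ _j : Fin d, (1 : ℝ) := Finset.sum_le_sum fun j _ =>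
        pow_le_one₀ (norm_nonneg _) (hl j).le
      simp only [Finset.sum_const, Finset.card_univ, Fintype.card_fin, nsmul_eq_mul, mul_one] at h1
      nlinarith [(Nat.cast_nonneg d : (0 : ℝ) ≤ d)]
    rw [FourierTransform.fourier_fourierInv_eq]
    have := b.one_of_mem_closedBall (x := l) (by simpa using hn)
    simp [this]
  · intro l hl j
    rw [FourierTransform.fourier_fourierInv_eq] at hl
    have h1 : b l ≠ 0 := by simpa using hl
    have h2 : l ∈ Function.support b := h1
    rw [b.support_eq] at h2
    have h3 : ‖l‖ < d + 2 := by simpa using h2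
    exact (PiLp.norm_apply_le l j).trans_lt h3

/-- Averaging over translates preserves the Schwartz class and multiplies the symbol by
`λ ↦ 𝓕 U (c λ)`. -/
theorem exists_fourierTransform_eq_average (U φ : 𝓢(Space d, ℂ)) (c : Fin d → ℝ) :
    ∃ χ : 𝓢(Space d, ℂ), (∀ l, χ l = 𝓕 U (dilation c l) * φ l) ∧
      ∀ x, fourierTransform χ x
        = ∫ v, U v * fourierTransform φ (x + dilation (fun j => 2 * Real.pi * c j) v) := by
  have hg := hasTemperateGrowth_fourier_dilation U c
  refine ⟨SchwartzMap.smulLeftCLM ℂ (fun l => 𝓕 U (dilation c l)) φ, fun l => ?_, fun x => ?_⟩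
  · rw [SchwartzMap.smulLeftCLM_apply_apply hg, smul_eq_mul]
  · rw [← fourierTransform_fourier_dilation_mul, SchwartzMap.smulLeftCLM_apply hg]
    rfl

/-- A section is reproduced by a low-pass filter which is adapted to a larger box. -/
theorem integral_fourierSection_mul_average {U : 𝓢(Space d, ℂ)} {R : ℝ} (hU : IsLowPass U R)
    {σ τ : Fin d → ℝ} (hσ : ∀ j, 0 < σ j) (hστ : ∀ j, σ j ≤ τ j) {p : ℝ} (hp : 1 < p)
    {f : Space d → ℂ} (hf : MemLp f (ENNReal.ofReal p) volume) (Φ : 𝓢(Space d, ℂ)) :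
    ∫ x, fourierSection σ f x *
        ∫ v, U v * Φ (x + dilation (fun j => 2 * Real.pi * (τ j)⁻¹) v)
      = ∫ x, fourierSection σ f x * Φ x := by
  obtain ⟨φ, hφ⟩ := exists_fourierTransform_eq Φ
  obtain ⟨χ, hχ, hχF⟩ := exists_fourierTransform_eq_average U φ fun j => (τ j)⁻¹
  rw [← hφ]
  simp_rw [← hχF]
  rw [integral_fourierSection_mul σ hσ p hp f hf, integral_fourierSection_mul σ hσ p hp f hf]
  have : (box σ).indicator χ = (box σ).indicator φ := by
    refine Set.indicator_congr fun l hl => ?_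
    rw [hχ, hU.eq_one _ fun j => ?_, one_mul]
    have hτ := (hσ j).trans_le (hστ j)
    rw [dilation_apply, abs_mul, abs_of_pos (inv_pos.2 hτ), inv_mul_lt_one₀ hτ]
    exact (hl j).trans_le (hστ j)
  rw [this]

/-- A low-pass filter does not see the difference between `f` and a section of `f` for a box which
contains the support of the symbol of the filter. -/
theorem integral_fourierSection_mul_average_of_le {U : 𝓢(Space d, ℂ)} {R : ℝ} (hU : IsLowPass U R)
    {σ τ : Fin d → ℝ} (hσ : ∀ j, 0 < σ j) (hτ : ∀ j, 0 < τ j) (hστ : ∀ j, R * τ j ≤ σ j)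
    {p : ℝ} (hp : 1 < p)
    {f : Space d → ℂ} (hf : MemLp f (ENNReal.ofReal p) volume) (Φ : 𝓢(Space d, ℂ)) :
    ∫ x, fourierSection σ f x *
        ∫ v, U v * Φ (x + dilation (fun j => 2 * Real.pi * (τ j)⁻¹) v)
      = ∫ x, f x * ∫ v, U v * Φ (x + dilation (fun j => 2 * Real.pi * (τ j)⁻¹) v) := by
  obtain ⟨φ, hφ⟩ := exists_fourierTransform_eq Φ
  obtain ⟨χ, hχ, hχF⟩ := exists_fourierTransform_eq_average U φ fun j => (τ j)⁻¹
  rw [← hφ]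
  simp_rw [← hχF]
  rw [integral_fourierSection_mul σ hσ p hp f hf]
  have : (box σ).indicator χ = χ := by
    refine Set.indicator_eq_self.2 fun l hl j => ?_
    have h0 : 𝓕 U (dilation (fun j => (τ j)⁻¹) l) ≠ 0 := fun h0 => hl (by rw [hχ, h0, zero_mul])
    have h1 := hU.lt_of_ne_zero _ h0 j
    rw [dilation_apply, abs_mul, abs_of_pos (inv_pos.2 (hτ j)), inv_mul_lt_iff₀ (hτ j),
      mul_comm] at h1
    exact h1.trans_le (hστ j)
  rw [this]

/-- A smooth compactly supported real function as a complex Schwartz function. -/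
def schwartzOfReal (g : Space d → ℝ) (hg : ContDiff ℝ ∞ g) (hgs : HasCompactSupport g) :
    𝓢(Space d, ℂ) :=
  HasCompactSupport.toSchwartzMap (f := fun x => (g x : ℂ))
    (hgs.comp_left (g := fun t : ℝ => (t : ℂ)) (by simp)) (Complex.ofRealCLM.contDiff.comp hg)

@[simp]
theorem schwartzOfReal_apply (g : Space d → ℝ) (hg : ContDiff ℝ ∞ g) (hgs : HasCompactSupport g)
    (x : Space d) : schwartzOfReal g hg hgs x = (g x : ℂ) := rfl

theorem hasCompactSupport_schwartzOfReal (g : Space d → ℝ) (hg : ContDiff ℝ ∞ g)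
    (hgs : HasCompactSupport g) : HasCompactSupport (schwartzOfReal g hg hgs) :=
  hgs.comp_left (g := fun t : ℝ => (t : ℂ)) (by simp)

/-- Two functions in Lebesgue spaces agree if their integrals against smooth functions with compact
support do. -/
theorem ae_eq_of_integral_mul_schwartz_eq {p q : ℝ≥0∞} (hp : 1 ≤ p) (hq : 1 ≤ q) {h k : Space d → ℂ}
    (hh : MemLp h p volume) (hk : MemLp k q volume)
    (H : ∀ Φ : 𝓢(Space d, ℂ), HasCompactSupport Φ → ∫ x, h x * Φ x = ∫ x, k x * Φ x) :
    h =ᵐ[volume] k := by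
  refine ae_eq_of_integral_contDiff_smul_eq (hh.locallyIntegrable hp) (hk.locallyIntegrable hq)
    fun g hg hgs => ?_
  have := H (schwartzOfReal g hg hgs) (hasCompactSupport_schwartzOfReal g hg hgs)
  simpa [mul_comm] using this

theorem memLp_comp_sub_dilation (c : Fin d → ℝ) (hc : ∀ j, 0 < c j) {p : ℝ≥0∞} {h : Space d → ℂ}
    (hh : MemLp h p volume) (x : Space d) : MemLp (fun v => h (x - dilation c v)) p volume :=
  memLp_comp_dilation c hc
    (hh.comp_measurePreserving (Measure.measurePreserving_sub_left (volume : Measure (Space d)) x))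

theorem integrable_mul_comp_sub_dilation (U : 𝓢(Space d, ℂ)) (c : Fin d → ℝ) (hc : ∀ j, 0 < c j)
    {h : Space d → ℂ} (hh : MemLp h ∞ volume) (x : Space d) :
    Integrable (fun v => U v * h (x - dilation c v)) volume :=
  U.integrable.mul_of_top_left (memLp_comp_sub_dilation c hc hh x)

/-- Hölder's inequality for averages; the power of the determinant of the dilation is the factor in
Nikol'skii's inequality. -/
theorem norm_smoothing_le {p q : ℝ≥0∞} [ENNReal.HolderConjugate p q] (U : 𝓢(Space d, ℂ))
    (c : Fin d → ℝ) (hc : ∀ j, 0 < c j) {h : Space d → ℂ} (hh : MemLp h p volume) (x : Space d) :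
    ‖smoothing U (dilation c) h x‖ ≤ (eLpNorm U q volume).toReal *
      (((∏ j, c j)⁻¹) ^ (1 / p).toReal * (eLpNorm h p volume).toReal) := by
  have hpr : 0 < ∏ j, c j := Finset.prod_pos fun j _ => hc j
  have hmp := Measure.measurePreserving_sub_left (volume : Measure (Space d)) x
  have h1 := integral_norm_mul_le (U.memLp q volume) (memLp_comp_sub_dilation c hc hh x)
  have h2 := eLpNorm_comp_dilation c hc (fun v => h (x - v)) p
  have h3 : eLpNorm (fun v => h (x - v)) p volume = eLpNorm h p volume :=
    eLpNorm_comp_measurePreserving hh.1 hmp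
  rw [h2, h3, ENNReal.toReal_mul, ← ENNReal.toReal_rpow,
    ENNReal.toReal_ofReal (inv_pos.2 hpr).le] at h1
  exact (norm_integral_le_integral_norm _).trans h1

theorem aestronglyMeasurable_smoothing (U : 𝓢(Space d, ℂ)) (M : Space d →L[ℝ] Space d)
    {h : Space d → ℂ} (hh : AEStronglyMeasurable h volume) :
    AEStronglyMeasurable (smoothing U M h) volume := by
  have hqm : Measure.QuasiMeasurePreserving (fun z : Space d × Space d => z.1 - M z.2)
      (volume.prod volume) volume := by
    have h1 : MeasurePreserving (fun z : Space d × Space d => (z.1, z.2 - M z.1))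
        (volume.prod volume) (volume.prod volume) := by
      refine (MeasurePreserving.id volume).skew_product (g := fun v x => x - M v) (by fun_prop) ?_
      exact Eventually.of_forall fun v => (measurePreserving_sub_right volume (M v)).map_eq
    exact (Measure.quasiMeasurePreserving_snd.comp h1.quasiMeasurePreserving).comp
      Measure.measurePreserving_swap.quasiMeasurePreserving
  have hm : AEStronglyMeasurable (fun z : Space d × Space d => U z.2 * h (z.1 - M z.2))
      (volume.prod volume) :=
    (U.continuous.aestronglyMeasurable.comp_snd).mul (hh.comp_quasiMeasurePreserving hqm)
  exact hm.integral_prod_right'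

theorem memLp_top_smoothing (U : 𝓢(Space d, ℂ)) (c : Fin d → ℝ) (hc : ∀ j, 0 < c j)
    {h : Space d → ℂ} (hh : MemLp h ∞ volume) : MemLp (smoothing U (dilation c) h) ∞ volume :=
  memLp_top_of_bound (aestronglyMeasurable_smoothing U _ hh.1) _
    (Eventually.of_forall (norm_smoothing_le (q := 1) U c hc hh))

theorem fourierSection_ae_eq_smoothing {U : 𝓢(Space d, ℂ)} {R : ℝ} (hU : IsLowPass U R)
    {σ τ : Fin d → ℝ} (hσ : ∀ j, 0 < σ j) (hστ : ∀ j, σ j ≤ τ j) {p : ℝ} (hp : 1 < p)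
    {f : Space d → ℂ} (hf : MemLp f (ENNReal.ofReal p) volume) :
    fourierSection σ f =ᵐ[volume]
      smoothing U (dilation fun j => 2 * Real.pi * (τ j)⁻¹) (fourierSection σ f) := by
  have hc : ∀ j, 0 < 2 * Real.pi * (τ j)⁻¹ := fun j =>
    mul_pos (by positivity) (inv_pos.2 ((hσ j).trans_le (hστ j)))
  have hS := memLp_top_fourierSection σ hσ p hp hf
  refine ae_eq_of_integral_mul_schwartz_eq le_top le_top hS (memLp_top_smoothing U _ hc hS)
    fun Φ _ => ?_
  rw [← integral_mul_integral_eq_integral_smoothing_mul (q := 1) U _ hS (Φ.memLp 1 volume)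
    Φ.continuous, integral_fourierSection_mul_average hU hσ hστ hp hf]

/-! ### Scales and layers -/

theorem scale_pos (r : Fin d → ℝ) (s : ℕ) (j : Fin d) : 0 < scale r s j := by
  unfold scale; positivity

theorem one_lt_base {r : Fin d → ℝ} (hr : ∀ j, 0 < r j) (hg : 0 < harmonicMean r) (j : Fin d) :
    1 < (2 : ℝ) ^ (harmonicMean r / r j) :=
  Real.one_lt_rpow one_lt_two (div_pos hg (hr j))

theorem scale_le_scale {r : Fin d → ℝ} (hr : ∀ j, 0 < r j) (hg : 0 < harmonicMean r) {s t : ℕ}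
    (hst : s ≤ t) (j : Fin d) : scale r s j ≤ scale r t j :=
  pow_le_pow_right₀ (one_lt_base hr hg j).le hst

theorem tendsto_scale {r : Fin d → ℝ} (hr : ∀ j, 0 < r j) (hg : 0 < harmonicMean r) (j : Fin d) :
    Tendsto (fun s => scale r s j) atTop atTop :=
  tendsto_pow_atTop_atTop_of_one_lt (one_lt_base hr hg j)

theorem prod_scale {r : Fin d → ℝ} (hg : 0 < harmonicMean r) (s : ℕ) :
    ∏ j, scale r s j = (2 : ℝ) ^ ((d : ℝ) * s) := by
  have h1 : ∑ j, harmonicMean r / r j = d := by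
    have h2 : (d : ℝ)⁻¹ * ∑ j, 1 / r j ≠ 0 := fun h =>
      hg.ne' (by rw [harmonicMean, h, inv_zero])
    have h3 : (d : ℝ) ≠ 0 := fun h => h2 (by rw [h, inv_zero, zero_mul])
    have h4 := right_ne_zero_of_mul h2
    simp_rw [div_eq_mul_one_div (harmonicMean r)]
    rw [← Finset.mul_sum, harmonicMean]
    field_simp
  simp only [scale]
  rw [Finset.prod_pow, ← Real.rpow_sum_of_pos two_pos, h1, ← Real.rpow_mul_natCast two_pos.le]

theorem memLp_top_layer (r : Fin d → ℝ) {p : ℝ} (hp : 1 < p)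
    {f : Space d → ℂ} (hf : MemLp f (ENNReal.ofReal p) volume) (s : ℕ) :
    MemLp (layer r f s) ∞ volume := by
  have h := fun t => memLp_top_fourierSection (scale r t) (scale_pos r t) p hp hf
  cases s with
  | zero => exact h 0
  | succ s => exact (h (s + 1)).sub (h s)

theorem sum_layer (r : Fin d → ℝ) (f : Space d → ℂ) (n : ℕ) (x : Space d) :
    ∑ s ∈ Finset.range (n + 1), layer r f s x = fourierSection (scale r n) f x := by
  induction n with
  | zero => simp [layer]
  | succ n ih => rw [Finset.sum_range_succ, ih, layer]; ring

theorem layer_ae_eq_smoothing {U : 𝓢(Space d, ℂ)} {R : ℝ} (hU : IsLowPass U R)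
    {r : Fin d → ℝ} (hr : ∀ j, 0 < r j) (hg : 0 < harmonicMean r) {p : ℝ} (hp : 1 < p)
    {f : Space d → ℂ} (hf : MemLp f (ENNReal.ofReal p) volume) (s : ℕ) :
    layer r f s =ᵐ[volume]
      smoothing U (dilation fun j => 2 * Real.pi * (scale r s j)⁻¹) (layer r f s) := by
  have hc : ∀ j, 0 < 2 * Real.pi * (scale r s j)⁻¹ := fun j =>
    mul_pos (by positivity) (inv_pos.2 (scale_pos r s j))
  have h := fun t (ht : t ≤ s) => fourierSection_ae_eq_smoothing hU (scale_pos r t)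
    (scale_le_scale hr hg ht) hp hf
  cases s with
  | zero => exact h 0 le_rfl
  | succ s =>
    have hi := fun t x => integrable_mul_comp_sub_dilation U _ hc
      (memLp_top_fourierSection (scale r t) (scale_pos r t) p hp hf) x
    filter_upwards [h (s + 1) le_rfl, h s s.le_succ] with x h1 h2
    simp only [layer]
    rw [h1, h2, smoothing, smoothing, smoothing, ← integral_sub (hi _ x) (hi _ x)]
    congr 1; funext v
    rw [mul_sub]

/-- Nikol'skii's inequality for the layers, `‖f_{a^s}‖_∞ ≤ K 2^{s d / p} ‖f_{a^s}‖_p`. -/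
theorem exists_norm_layer_le {r : Fin d → ℝ} (hr : ∀ j, 0 < r j) (hg : 0 < harmonicMean r)
    {p : ℝ} (hp : 1 < p) :
    ∃ K : ℝ, 0 ≤ K ∧ ∀ (f : Space d → ℂ) (s : ℕ), MemLp f (ENNReal.ofReal p) volume →
      eLpNorm (layer r f s) (ENNReal.ofReal p) volume ≠ ⊤ →
      ∀ᵐ x, ‖layer r f s x‖ ≤ K * (2 : ℝ) ^ (s * (d / p)) *
        (eLpNorm (layer r f s) (ENNReal.ofReal p) volume).toReal := by
  obtain ⟨U, R, hU⟩ := exists_isLowPass d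
  have := (Real.HolderConjugate.conjExponent hp).ennrealOfReal
  refine ⟨(eLpNorm U (ENNReal.ofReal p.conjExponent) volume).toReal *
    (((2 * Real.pi) ^ d)⁻¹) ^ (1 / p), by positivity, fun f s hf hfin => ?_⟩
  have hc : ∀ j, 0 < 2 * Real.pi * (scale r s j)⁻¹ := fun j =>
    mul_pos (by positivity) (inv_pos.2 (scale_pos r s j))
  have hl : MemLp (layer r f s) (ENNReal.ofReal p) volume :=
    ⟨(memLp_top_layer r hp hf s).1, hfin.lt_top⟩
  filter_upwards [layer_ae_eq_smoothing hU hr hg hp hf s] with x hx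
  have h1 := norm_smoothing_le (q := ENNReal.ofReal p.conjExponent) U _ hc hl x
  rw [← hx] at h1
  refine h1.trans_eq ?_
  have hp0 : 0 < p := zero_lt_one.trans hp
  have e : (1 / ENNReal.ofReal p).toReal = 1 / p := by
    rw [one_div, ENNReal.toReal_inv, ENNReal.toReal_ofReal hp0.le, one_div]
  have e2 : ((∏ j, 2 * Real.pi * (scale r s j)⁻¹)⁻¹) ^ (1 / p)
      = (((2 * Real.pi) ^ d)⁻¹) ^ (1 / p) * (2 : ℝ) ^ (s * (d / p)) := by
    rw [Finset.prod_mul_distrib, Finset.prod_inv_distrib, prod_scale hg, mul_inv, inv_inv,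
      Real.mul_rpow (by positivity) (by positivity), ← Real.rpow_mul two_pos.le]
    simp only [Finset.prod_const, Finset.card_univ, Fintype.card_fin]
    congr 2
    ring
  rw [e, e2]
  ring

/-! ### Convergence of the layers -/

/-- Averages over shrinking translates converge weakly to the identity. -/
theorem tendsto_integral_mul_average {U : 𝓢(Space d, ℂ)} {R : ℝ} (hU : IsLowPass U R)
    {r : Fin d → ℝ} (hr : ∀ j, 0 < r j) (hg : 0 < harmonicMean r)
    {p q : ℝ≥0∞} [ENNReal.HolderConjugate p q] {h : Space d → ℂ} (hh : MemLp h p volume)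
    (Φ : 𝓢(Space d, ℂ)) (hΦ : HasCompactSupport Φ) :
    Tendsto (fun s => ∫ x, h x *
        ∫ v, U v * Φ (x + dilation (fun j => 2 * Real.pi * (scale r s j)⁻¹) v)) atTop
      (𝓝 (∫ x, h x * Φ x)) := by
  have hp : 1 ≤ p := ENNReal.HolderConjugate.one_le p q
  -- after Fubini the integral is `∫ U(v) H(M v) dv`, and `H` is bounded and continuous
  set H : Space d → ℂ := fun z => ∫ x, h x * Φ (x + z) with hH
  have hHc : Continuous H := by
    have h1 : Continuous (MeasureTheory.convolution h (fun u => Φ (-u))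
        (ContinuousLinearMap.mul ℝ ℂ) volume) :=
      HasCompactSupport.continuous_convolution_right _
        (hΦ.comp_homeomorph (Homeomorph.neg (Space d))) (hh.locallyIntegrable hp) (by fun_prop)
    refine (h1.comp continuous_neg).congr fun z => ?_
    simp [convolution_def, hH, add_comm]
  have hHb : ∀ z, ‖H z‖ ≤ (eLpNorm h p volume).toReal * (eLpNorm Φ q volume).toReal := by
    intro z
    have h1 := integral_norm_mul_le hh (memLp_comp_add_right (Φ.memLp q volume) z)
    rw [eLpNorm_comp_add_right (Φ.memLp q volume)] at h1
    exact (norm_integral_le_integral_norm _).trans h1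
  have hU1 : ∫ v, U v = 1 := by
    have h1 := hU.eq_one 0 (by simp)
    rw [SchwartzMap.fourier_coe, Real.fourier_eq'] at h1
    simpa using h1
  have hlim : ∫ x, h x * Φ x = ∫ v, U v * H 0 := by
    rw [integral_mul_const, hU1, one_mul, hH]
    simp
  simp_rw [integral_mul_integral_eq_integral_mul_integral (q := q) U _ hh (Φ.memLp q volume)
    Φ.continuous]
  rw [hlim]
  refine tendsto_integral_of_dominated_convergence
    (fun v => ‖U v‖ * ((eLpNorm h p volume).toReal * (eLpNorm Φ q volume).toReal))
    (fun s => ?_) (U.integrable.norm.mul_const _) (fun s => Eventually.of_forall fun v => ?_)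
    (Eventually.of_forall fun v => ?_)
  · exact Continuous.aestronglyMeasurable (U.continuous.mul (hHc.comp (by fun_prop)))
  · rw [norm_mul]
    exact mul_le_mul_of_nonneg_left (hHb _) (norm_nonneg _)
  · refine Tendsto.const_mul _ ((hHc.tendsto 0).comp ?_)
    have h0 : Tendsto (fun s => (fun j => 2 * Real.pi * (scale r s j)⁻¹ * v j)) atTop
        (𝓝 (0 : Fin d → ℝ)) := by
      refine tendsto_pi_nhds.2 fun j => ?_
      have := (((tendsto_scale hr hg j).inv_tendsto_atTop).const_mul (2 * Real.pi)).mul_const (v j)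
      simpa using this
    exact ((PiLp.continuous_toLp 2 _).tendsto 0).comp h0

/-- If the sections of `f` are dominated by a constant and converge almost everywhere, then the limit
is `f`. -/
theorem ae_eq_of_tendsto_fourierSection {r : Fin d → ℝ} (hr : ∀ j, 0 < r j)
    (hg : 0 < harmonicMean r) {p : ℝ} (hp : 1 < p) {f G : Space d → ℂ}
    (hf : MemLp f (ENNReal.ofReal p) volume) (K : ℝ)
    (hK : ∀ m, ∀ᵐ x, ‖fourierSection (scale r m) f x‖ ≤ K)
    (hG : ∀ᵐ x, Tendsto (fun m => fourierSection (scale r m) f x) atTop (𝓝 (G x))) :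
    f =ᵐ[volume] G := by
  obtain ⟨U, R, hU⟩ := exists_isLowPass d
  have hpq := (Real.HolderConjugate.conjExponent hp).ennrealOfReal
  have hm := fun m => aestronglyMeasurable_fourierSection (scale r m) hf.1
  have hG1 : MemLp G ∞ volume := by
    refine memLp_top_of_bound (aestronglyMeasurable_of_tendsto_ae atTop hm hG) K ?_
    filter_upwards [ae_all_iff.2 hK, hG] with x h1 h2
    exact le_of_tendsto h2.norm (Eventually.of_forall h1)
  refine ae_eq_of_integral_mul_schwartz_eq
    (ENNReal.HolderConjugate.one_le _ (ENNReal.ofReal p.conjExponent)) le_top hf hG1 fun Φ hΦ => ?_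
  refine tendsto_nhds_unique (tendsto_integral_mul_average (q := ENNReal.ofReal p.conjExponent)
    hU hr hg hf Φ hΦ) ?_
  refine (tendsto_integral_mul_average (q := 1) hU hr hg hG1 Φ hΦ).congr fun s => ?_
  obtain ⟨φ, hφ⟩ := exists_fourierTransform_eq Φ
  obtain ⟨χ, -, hχF⟩ := exists_fourierTransform_eq_average U φ fun j => (scale r s j)⁻¹
  have hint : Integrable (fun x => ∫ v, U v *
      Φ (x + dilation (fun j => 2 * Real.pi * (scale r s j)⁻¹) v)) volume := by
    rw [← hφ]
    simp_rw [← hχF]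
    exact integrable_fourierTransform_schwartz χ
  -- at a fixed scale `s` of the average, let the order `m` of the section tend to infinity
  refine tendsto_nhds_unique (f := fun m => ∫ x, fourierSection (scale r m) f x *
    ∫ v, U v * Φ (x + dilation (fun j => 2 * Real.pi * (scale r s j)⁻¹) v)) (l := atTop) ?_ ?_
  · refine tendsto_integral_of_dominated_convergence (fun x => K * ‖∫ v, U v *
      Φ (x + dilation (fun j => 2 * Real.pi * (scale r s j)⁻¹) v)‖)
      (fun m => (hm m).mul hint.1) (hint.norm.const_mul K) (fun m => ?_) ?_
    · filter_upwards [hK m] with x hx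
      rw [norm_mul]
      exact mul_le_mul_of_nonneg_right hx (norm_nonneg _)
    · filter_upwards [hG] with x hx
      exact hx.mul_const _
  · refine tendsto_const_nhds.congr' ?_
    have : ∀ᶠ m in atTop, ∀ j, R * scale r s j ≤ scale r m j :=
      eventually_all.2 fun j => (tendsto_scale hr hg j).eventually_ge_atTop _
    filter_upwards [this] with m hm'
    rw [integral_fourierSection_mul_average_of_le hU (scale_pos r m) (scale_pos r s) hm' hp hf]

/-! ### The upper bound -/

theorem ennreal_rpow_le_one_iff {x : ℝ≥0∞} {z : ℝ} (hz : 0 < z) : x ^ z ≤ 1 ↔ x ≤ 1 := by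
  simpa using ENNReal.rpow_le_rpow_iff (x := x) (y := 1) hz

theorem eLpNorm_layer_le_of_besovNorm_le_one {r : Fin d → ℝ} {p θ : ℝ≥0∞} (hθ : 1 ≤ θ)
    {f : Space d → ℂ} (hf : besovNorm r p θ f ≤ 1) (s : ℕ) :
    ENNReal.ofReal (((2 : ℝ) ^ harmonicMean r) ^ s) * eLpNorm (layer r f s) p volume ≤ 1 := by
  unfold besovNorm at hf
  split_ifs at hf with h
  · exact (le_iSup (fun s => ENNReal.ofReal (((2 : ℝ) ^ harmonicMean r) ^ s) *
      eLpNorm (layer r f s) p volume) s).trans hf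
  · have hpos : 0 < θ.toReal := ENNReal.toReal_pos (zero_lt_one.trans_le hθ).ne' h
    rw [ennreal_rpow_le_one_iff (one_div_pos.2 hpos)] at hf
    have h1 := (ENNReal.le_tsum s).trans hf
    rwa [ennreal_rpow_le_one_iff hpos] at h1

theorem toReal_eLpNorm_layer_le {r : Fin d → ℝ} {p θ : ℝ≥0∞} (hθ : 1 ≤ θ)
    {f : Space d → ℂ} (hf : besovNorm r p θ f ≤ 1) (s : ℕ) :
    eLpNorm (layer r f s) p volume ≠ ⊤ ∧
      (eLpNorm (layer r f s) p volume).toReal ≤ (((2 : ℝ) ^ harmonicMean r) ^ s)⁻¹ := by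
  have h := eLpNorm_layer_le_of_besovNorm_le_one hθ hf s
  have hb : 0 < ((2 : ℝ) ^ harmonicMean r) ^ s := by positivity
  have h1 : eLpNorm (layer r f s) p volume ≠ ⊤ := by
    intro h2
    rw [h2, ENNReal.mul_top (by simpa using hb)] at h
    simp at h
  refine ⟨h1, ?_⟩
  have h2 := ENNReal.toReal_mono ENNReal.one_ne_top h
  rw [ENNReal.toReal_mul, ENNReal.toReal_ofReal hb.le, ENNReal.toReal_one] at h2
  rwa [← one_div, le_div_iff₀' hb]

/-- The error is the tail of the series of the layers, which is dominated by a geometric series. -/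
theorem exists_norm_sub_fourierSection_le {r : Fin d → ℝ} (hr : ∀ j, 0 < r j) {p : ℝ} (hp : 1 < p)
    (hg : (d : ℝ) / p < harmonicMean r) {θ : ℝ≥0∞} (hθ : 1 ≤ θ) :
    ∃ C : ℝ, 0 < C ∧ ∀ f ∈ besovClass r (ENNReal.ofReal p) θ, ∀ n : ℕ,
      ∀ᵐ x, ‖f x - fourierSection (scale r n) f x‖
        ≤ C * (2 : ℝ) ^ (-((n + 1 : ℕ) : ℝ) * (harmonicMean r - d / p)) := by
  have hp0 : 0 < p := zero_lt_one.trans hp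
  have hg0 : 0 < harmonicMean r := lt_of_le_of_lt (by positivity) hg
  obtain ⟨K, hK0, hK⟩ := exists_norm_layer_le hr hg0 hp
  set ρ : ℝ := (2 : ℝ) ^ (-(harmonicMean r - d / p)) with hρ
  have hρ0 : 0 < ρ := by positivity
  have hρ1 : ρ < 1 := Real.rpow_lt_one_of_one_lt_of_neg one_lt_two (by linarith)
  refine ⟨K / (1 - ρ) + 1, by have := sub_pos.2 hρ1; positivity, fun f hf n => ?_⟩
  have hlayer : ∀ s, ∀ᵐ x, ‖layer r f s x‖ ≤ K * ρ ^ s := by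
    intro s
    obtain ⟨h1, h2⟩ := toReal_eLpNorm_layer_le hθ hf.2 s
    filter_upwards [hK f s hf.1 h1] with x hx
    refine hx.trans ((mul_le_mul_of_nonneg_left h2 (by positivity)).trans_eq ?_)
    rw [mul_assoc, hρ, ← Real.rpow_mul_natCast two_pos.le, ← Real.rpow_mul_natCast two_pos.le,
      ← Real.rpow_neg two_pos.le, ← Real.rpow_add two_pos]
    congr 2
    ring
  have hgeom : Summable fun s : ℕ => K * ρ ^ s :=
    (summable_geometric_of_lt_one hρ0.le hρ1).mul_left K
  have hall := ae_all_iff.2 hlayer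
  have hsum : f =ᵐ[volume] fun x => ∑' s, layer r f s x := by
    refine ae_eq_of_tendsto_fourierSection hr hg0 hp hf.1 (∑' s : ℕ, K * ρ ^ s) (fun m => ?_) ?_
    · filter_upwards [hall] with x hx
      rw [← sum_layer]
      refine (norm_sum_le _ _).trans ((Finset.sum_le_sum fun s _ => hx s).trans ?_)
      exact hgeom.sum_le_tsum _ fun s _ => by positivity
    · filter_upwards [hall] with x hx
      have h1 := (Summable.of_norm_bounded hgeom hx).hasSum.tendsto_sum_nat
      simp_rw [← sum_layer]
      exact (tendsto_add_atTop_iff_nat 1).2 h1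
  filter_upwards [hall, hsum] with x hx hfx
  have h1 := (Summable.of_norm_bounded hgeom hx).sum_add_tsum_nat_add (n + 1)
  rw [hfx, ← h1, sum_layer, add_sub_cancel_left]
  have h2 : HasSum (fun s : ℕ => K * ρ ^ (s + (n + 1))) (K * ρ ^ (n + 1) * (1 - ρ)⁻¹) := by
    have e : (fun s : ℕ => K * ρ ^ (s + (n + 1))) = fun s => K * ρ ^ (n + 1) * ρ ^ s := by
      funext s; ring
    rw [e]
    exact (hasSum_geometric_of_lt_one hρ0.le hρ1).mul_left _
  refine (tsum_of_norm_bounded h2 fun s => hx _).trans ?_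
  have h3 : (2 : ℝ) ^ (-((n + 1 : ℕ) : ℝ) * (harmonicMean r - d / p)) = ρ ^ (n + 1) := by
    rw [hρ, ← Real.rpow_mul_natCast two_pos.le]
    congr 1
    ring
  rw [h3, add_mul, one_mul]
  have h4 : K * ρ ^ (n + 1) * (1 - ρ)⁻¹ = K / (1 - ρ) * ρ ^ (n + 1) := by ring
  rw [h4]
  exact le_add_of_nonneg_right (by positivity)

/-! ### The lower bound -/

theorem fourierSection_comp_dilation (σ c : Fin d → ℝ) (hc : ∀ j, 0 < c j) (h : Space d → ℂ)
    (x : Space d) :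
    fourierSection σ (fun y => h (dilation c y)) x
      = fourierSection (fun j => σ j / c j) h (dilation c x) := by
  have hp : 0 < ∏ j, c j := Finset.prod_pos fun j _ => hc j
  have hk : ∀ t : Space d, kernel σ t
      = (∏ j, c j) * kernel (fun j => σ j / c j) (dilation c t) := by
    intro t
    simp only [kernel, dilation_apply]
    rw [mul_left_comm, ← Finset.prod_mul_distrib]
    congr 1
    refine Finset.prod_congr rfl fun j _ => ?_
    have := (hc j).ne'
    rw [← mul_assoc, mul_div_cancel₀ _ this, ← mul_assoc, div_mul_cancel₀ _ this]
  have h1 := integral_comp_dilation c hc fun y =>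
    h y * (kernel (fun j => σ j / c j) (dilation c x - y) : ℂ)
  have h2 : ∀ y, h (dilation c y) * (kernel σ (x - y) : ℂ) = ((∏ j, c j : ℝ) : ℂ) *
      (h (dilation c y) *
        (kernel (fun j => σ j / c j) (dilation c x - dilation c y) : ℂ)) := by
    intro y
    rw [hk, map_sub]
    push_cast
    ring
  rw [fourierSection, integral_congr_ae (Eventually.of_forall h2), integral_const_mul, h1,
    ← mul_assoc, ← Complex.ofReal_mul, mul_inv_cancel₀ hp.ne', Complex.ofReal_one, one_mul]
  rfl

theorem fourierSection_const_mul (σ : Fin d → ℝ) (κ : ℂ) (h : Space d → ℂ) (x : Space d) :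
    fourierSection σ (fun y => κ * h y) x = κ * fourierSection σ h x := by
  simp only [fourierSection, mul_assoc]
  rw [integral_const_mul]

/-- A symbol which is supported in the unit box and off the box of the previous scale; the latter
is ensured by a single coordinate `j₀`. -/
theorem exists_fourierTransform_supported (j₀ : Fin d) {a : ℝ} (ha : 1 < a) :
    ∃ η : 𝓢(Space d, ℂ), (∃ l, η l ≠ 0) ∧
      ∀ l, η l ≠ 0 → (∀ j, |l j| < 1) ∧ a⁻¹ < |l j₀| := by
  have ha0 : 0 < a := zero_lt_one.trans ha
  have hinv : a⁻¹ < 1 := inv_lt_one_of_one_lt₀ ha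
  have hinv0 : 0 < a⁻¹ := inv_pos.2 ha0
  set l₀ : Space d := EuclideanSpace.single j₀ ((1 + a⁻¹) / 2) with hl₀
  have hopen : IsOpen {l : Space d | (∀ j, |l j| < 1) ∧ a⁻¹ < |l j₀|} := by
    refine IsOpen.and ?_ (isOpen_lt continuous_const (by fun_prop))
    simp only [Set.ofPred_forall]
    exact isOpen_iInter_of_finite fun j => isOpen_lt (by fun_prop) continuous_const
  have hmem : l₀ ∈ {l : Space d | (∀ j, |l j| < 1) ∧ a⁻¹ < |l j₀|} := by
    refine ⟨fun j => ?_, ?_⟩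
    · by_cases h : j = j₀
      · subst h
        rw [hl₀, PiLp.single_apply, if_pos rfl, abs_of_pos (by linarith)]
        linarith
      · rw [hl₀, PiLp.single_apply, if_neg h, abs_zero]
        exact one_pos
    · rw [hl₀, PiLp.single_apply, if_pos rfl, abs_of_pos (by linarith)]
      linarith
  obtain ⟨g, hg1, hg2, hg3, -, hg4⟩ :=
    exists_contDiff_tsupport_subset (n := ⊤) (hopen.mem_nhds hmem)
  refine ⟨schwartzOfReal g hg3 hg2, ⟨l₀, by simp [hg4]⟩, fun l hl => ?_⟩
  exact hg1 (subset_tsupport g fun h => hl (by simp [h]))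

theorem besovNorm_le_one_of_layer_eq_zero {r : Fin d → ℝ} {p θ : ℝ≥0∞} (hθ : 1 ≤ θ)
    {f : Space d → ℂ} {n : ℕ} (h0 : ∀ s, s ≠ n → layer r f s = 0)
    (hn : ENNReal.ofReal (((2 : ℝ) ^ harmonicMean r) ^ n) * eLpNorm (layer r f n) p volume ≤ 1) :
    besovNorm r p θ f ≤ 1 := by
  unfold besovNorm
  split_ifs with h
  · refine iSup_le fun s => ?_
    by_cases hs : s = n
    · subst hs; exact hn
    · simp [h0 s hs]
  · have hpos : 0 < θ.toReal := ENNReal.toReal_pos (zero_lt_one.trans_le hθ).ne' h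
    rw [tsum_eq_single n fun s hs => by simp [h0 s hs, hpos], ennreal_rpow_le_one_iff
      (one_div_pos.2 hpos), ennreal_rpow_le_one_iff hpos]
    exact hn

/-- If the symbol of `H` lives between two consecutive scales, then the dilation `H(a^n x)` consists
of a single layer. -/
theorem fourierSection_scale_comp_dilation {r : Fin d → ℝ} (hr : ∀ j, 0 < r j)
    (hg : 0 < harmonicMean r) {j₀ : Fin d} {η : 𝓢(Space d, ℂ)}
    (hη : ∀ l, η l ≠ 0 → (∀ j, |l j| < 1) ∧ ((2 : ℝ) ^ (harmonicMean r / r j₀))⁻¹ < |l j₀|)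
    (κ : ℂ) (n s : ℕ) (x : Space d) :
    fourierSection (scale r s) (fun y => κ * fourierTransform η (dilation (scale r n) y)) x
      = if n ≤ s then κ * fourierTransform η (dilation (scale r n) x) else 0 := by
  have hσ : ∀ j, 0 < scale r s j / scale r n j := fun j => div_pos (scale_pos r s j) (scale_pos r n j)
  rw [fourierSection_const_mul, fourierSection_comp_dilation _ _ (scale_pos r n),
    fourierSection_fourierTransform _ hσ]
  split_ifs with h
  · have : (box fun j => scale r s j / scale r n j).indicator η = η := by
      refine Set.indicator_eq_self.2 fun l hl j => ((hη l hl).1 j).trans_le ?_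
      rw [one_le_div (scale_pos r n j)]
      exact scale_le_scale hr hg h j
    rw [this]
  · have : (box fun j => scale r s j / scale r n j).indicator η = 0 := by
      refine Set.indicator_eq_zero.2 (Set.disjoint_left.2 fun l hl hb => ?_)
      refine absurd ((hη l hl).2.trans (hb j₀)) (not_lt.2 ?_)
      have ha : 0 < (2 : ℝ) ^ (harmonicMean r / r j₀) := by positivity
      rw [div_le_iff₀ (scale_pos r n j₀), le_inv_mul_iff₀ ha]
      have := scale_le_scale hr hg (Nat.succ_le_of_lt (not_le.1 h)) j₀
      rwa [scale, Nat.succ_eq_add_one, pow_succ'] at this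
    rw [this]
    simp [fourierTransform]

theorem exists_le_classError {r : Fin d → ℝ} (hd : 1 ≤ d) (hr : ∀ j, 0 < r j) {p : ℝ} (hp : 1 < p)
    (hg : 0 < harmonicMean r) {θ : ℝ≥0∞} (hθ : 1 ≤ θ) :
    ∃ c : ℝ, 0 < c ∧ ∀ n : ℕ, 1 ≤ n →
      ENNReal.ofReal (c * (2 : ℝ) ^ (-(n : ℝ) * (harmonicMean r - d / p)))
        ≤ classError r n (besovClass r (ENNReal.ofReal p) θ) := by
  have hp0 : 0 < p := zero_lt_one.trans hp
  obtain ⟨η, ⟨l₀, hl₀⟩, hη⟩ := exists_fourierTransform_supported ⟨0, hd⟩ (one_lt_base hr hg ⟨0, hd⟩)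
  set H := schwartzFourier η with hH
  have hHη : ⇑H = fourierTransform η := coe_schwartzFourier η
  have hne : ∀ q : ℝ≥0∞, q ≠ 0 → 0 < (eLpNorm H q volume).toReal := by
    intro q hq
    refine ENNReal.toReal_pos (fun h => hl₀ ?_) (H.memLp q volume).2.ne
    rw [eLpNorm_eq_zero_iff H.continuous.aestronglyMeasurable hq] at h
    have h1 := (Continuous.ae_eq_iff_eq volume H.continuous continuous_zero).1 h
    rw [← neg_neg l₀, ← fourierTransform_fourierTransform, ← hHη, h1]
    simp [fourierTransform]
  set Np := (eLpNorm H (ENNReal.ofReal p) volume).toReal with hNp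
  set Ni := (eLpNorm H ⊤ volume).toReal with hNi
  have hNp0 : 0 < Np := hne _ (by simpa using hp0)
  have hNi0 : 0 < Ni := hne _ (by simp)
  refine ⟨Ni / Np, div_pos hNi0 hNp0, fun n hn => ?_⟩
  -- the factor for which `κ H(a^n x)` has Besov norm `1`; by scaling,
  -- `‖H(a^n x)‖_p = 2^{-n d / p} ‖H‖_p`
  set κ : ℝ := (2 : ℝ) ^ (-(n : ℝ) * (harmonicMean r - d / p)) / Np with hκ
  have hκ0 : 0 < κ := by positivity
  set f : Space d → ℂ := fun y => (κ : ℂ) * fourierTransform η (dilation (scale r n) y) with hf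
  have hnorm : ∀ q : ℝ≥0∞, eLpNorm f q volume = ENNReal.ofReal κ *
      (ENNReal.ofReal ((∏ j, scale r n j)⁻¹) ^ (1 / q).toReal * eLpNorm H q volume) := by
    intro q
    rw [← eLpNorm_comp_dilation _ (scale_pos r n), hHη]
    have := eLpNorm_const_smul (μ := volume) (κ : ℂ)
      (fun x => fourierTransform η (dilation (scale r n) x)) q
    rw [← ofReal_norm, Complex.norm_of_nonneg hκ0.le] at this
    exact this
  have hsec : ∀ s x, fourierSection (scale r s) f x = if n ≤ s then f x else 0 :=
    fourierSection_scale_comp_dilation hr hg hη κ n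
  have hlayer : ∀ s, s ≠ n → layer r f s = 0 := by
    intro s hs
    funext x
    cases s with
    | zero => simp [layer, hsec, show ¬ n ≤ 0 by omega]
    | succ s =>
      simp only [layer, hsec]
      by_cases h : n ≤ s
      · simp [h, h.trans s.le_succ]
      · simp [h, show ¬ n ≤ s + 1 by omega]
  have hlayern : layer r f n = f := by
    obtain ⟨m, rfl⟩ : ∃ m, n = m + 1 := ⟨n - 1, by omega⟩
    funext x
    simp [layer, hsec]
  have hmem : f ∈ besovClass r (ENNReal.ofReal p) θ := by
    refine ⟨(memLp_comp_dilation _ (scale_pos r n) (hHη ▸ H.memLp _ volume)).const_mul _,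
      besovNorm_le_one_of_layer_eq_zero hθ hlayer ?_⟩
    have e : (1 / ENNReal.ofReal p).toReal = 1 / p := by
      rw [one_div, ENNReal.toReal_inv, ENNReal.toReal_ofReal hp0.le, one_div]
    rw [hlayern, hnorm, ← ENNReal.ofReal_toReal (H.memLp (ENNReal.ofReal p) volume).2.ne, ← hNp, e,
      prod_scale hg, ENNReal.ofReal_rpow_of_pos (by positivity),
      ← ENNReal.ofReal_mul (by positivity), ← ENNReal.ofReal_mul (by positivity),
      ← ENNReal.ofReal_mul (by positivity), ENNReal.ofReal_le_one]
    refine le_of_eq ?_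
    have e2 : ((2 : ℝ) ^ harmonicMean r) ^ n * (2 : ℝ) ^ (-(n : ℝ) * (harmonicMean r - d / p)) *
        (((2 : ℝ) ^ ((d : ℝ) * n))⁻¹) ^ (1 / p) = 1 := by
      rw [← Real.rpow_neg two_pos.le, ← Real.rpow_mul two_pos.le,
        ← Real.rpow_mul_natCast two_pos.le, ← Real.rpow_add two_pos, ← Real.rpow_add two_pos]
      convert Real.rpow_zero (2 : ℝ) using 2
      field_simp
      ring
    rw [hκ]
    calc _ = (((2 : ℝ) ^ harmonicMean r) ^ n *
          (2 : ℝ) ^ (-(n : ℝ) * (harmonicMean r - d / p)) *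
          (((2 : ℝ) ^ ((d : ℝ) * n))⁻¹) ^ (1 / p)) * (Np / Np) := by ring
      _ = 1 := by rw [e2, div_self hNp0.ne', one_mul]
  refine le_iSup₂_of_le f hmem ?_
  have herr : sectionError r n f = eLpNorm f ⊤ volume := by
    unfold sectionError
    congr 1
    funext x
    rw [hsec, if_neg (by omega), sub_zero]
  rw [herr, hnorm, ← ENNReal.ofReal_toReal (H.memLp ⊤ volume).2.ne, ← hNi]
  simp only [ENNReal.div_top, ENNReal.toReal_zero, ENNReal.rpow_zero, one_mul]
  rw [← ENNReal.ofReal_mul hκ0.le]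
  refine ENNReal.ofReal_le_ofReal (le_of_eq ?_)
  rw [hκ]
  ring

end

end NikolskiiBesov

theorem mainTheorem1 (d : ℕ) (hd : 1 ≤ d) (p : ℝ) (hp : 1 < p) (θ : ℝ≥0∞) (hθ : 1 ≤ θ)
    (r : Fin d → ℝ) (hr : ∀ j, 0 < r j) (hg : (d : ℝ) / p < harmonicMean r) :
    (∀ f ∈ besovClass r (ENNReal.ofReal p) θ, MemLp f ∞ volume) ∧
    ∃ c C : ℝ, 0 < c ∧ 0 < C ∧ ∀ n : ℕ, 1 ≤ n →
      ENNReal.ofReal (c * (2 : ℝ) ^ (-(n : ℝ) * (harmonicMean r - d / p)))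
          ≤ classError r n (besovClass r (ENNReal.ofReal p) θ) ∧
      classError r n (besovClass r (ENNReal.ofReal p) θ)
          ≤ ENNReal.ofReal (C * (2 : ℝ) ^ (-(n : ℝ) * (harmonicMean r - d / p))) := by
  have hp0 : 0 < p := zero_lt_one.trans hp
  have hg0 : 0 < harmonicMean r := lt_of_le_of_lt (by positivity) hg
  obtain ⟨C, hC0, hC⟩ := exists_norm_sub_fourierSection_le hr hp hg hθ
  obtain ⟨c, hc0, hc⟩ := exists_le_classError hd hr hp hg0 hθ
  refine ⟨fun f hf => ?_, c, C, hc0, hC0, fun n hn => ⟨hc n hn, iSup₂_le fun f hf => ?_⟩⟩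
  · have hS := memLp_top_fourierSection (scale r 0) (scale_pos r 0) p hp hf.1
    have hD : MemLp (fun x => f x - fourierSection (scale r 0) f x) ∞ volume :=
      memLp_top_of_bound (hf.1.1.sub hS.1) _ (hC f hf 0)
    exact (memLp_congr_ae (Filter.Eventually.of_forall fun x => sub_add_cancel _ _)).1 (hD.add hS)
  · have h := hC f hf (n - 1)
    rw [Nat.sub_add_cancel hn] at h
    rw [sectionError, eLpNorm_exponent_top]
    exact eLpNormEssSup_le_of_ae_bound h
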